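/- **Setting.** Let $d\ge 1$, $\mathbb{T}^d=\mathbb{R}^d/\mathbb{Z}^d$, and let $w(x)=\left(\int_0^1 e^{-1/(s(1-s))}\,ds\right)^{-1}e^{-1/(x(1-x))}$ for $x\in(0,1)$ and $w(x)=0$ otherwise. For $\rho,\theta\in\mathbb{T}^d$, $f:\mathbb{T}^d\to\mathbb{C}$ and $N\ge 2$ put $A_N=\sum_{n=0}^{N-1}w(n/N)$ and $$\mathbf{Error}_N(\theta)=\left|\frac1{A_N}\sum_{n=0}^{N-1}w(n/N)\,f(\theta+n\rho)-\int_{\mathbb{T}^d}f(x)\,dx\right| .$$ We write $\mathbf{Error}_N=\mathcal{O}(g(N))$ if there are $K$ and $N_0$, which may depend on everything except $\theta$, such that $\mathbf{Error}_N(\theta)\le K g(N)$ for all $N\ge N_0$ and all $\theta\in\mathbb{T}^d$. The function $f$ is called analytic if its lift to $\mathbb{R}^d$ is real analytic. We say that $f$ has analyticity radius at least $r>0$ if, around every point $x\in\mathbb{R}^d$, the lift equals on the sup-norm ball $\{x+h:|h|_\infty<r\}$ the sum $\sum_{n\ge0}p_n(h,\dots,h)$ for some bounded $n$-linear maps $p_n$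 (depending on $x$) with $\limsup_n\|p_n\|^{1/n}\le 1/r$; $f$ is analytic if and only if this holds for some $r>0$. Write $|k|=\sum_j|k_j|$ for $k\in\mathbb{Z}^d$. **Theorem.** (I) There is an absolute constant $c_{\rm I}>0$ such that for every $d\ge1$ and Lebesgue-almost every $\rho\in\mathbb{T}^d$, for all analytic $f$ and all $\zeta>1$, $$\mathbf{Error}_N=\mathcal{O}\left(\exp\left(-c_{\rm I}N^{\frac1{d+2}}(\ln N)^{-\frac{\zeta}{d+2}}\right)\right).$$ (II) For all $d\ge1$, $C>0$ and $r>0$ there is $c_{\rm II}=c_{\rm II}(d,C,r)>0$ such that, for every $\rho$ with $|k\cdot\rho-n|>C/|k|^{d}$ for all $0\ne k\in\mathbb{Z}^d$ and $n\in\mathbb{Z}$, and every analytic $f$ with analyticity radius at least $r$, $$\mathbf{Error}_N=\mathcal{O}\left(\exp\left(-c_{\rm II}N^{\frac1{d+2}}\right)\right).$$ (III) For every $d\ge1$ and Lebesgue-almost every $\rho\in\mathbb{T}^d$: for every finite set $S\subset\mathbb{Z}^d$ there is $c_{\rm III}=c_{\rm III}(\rho,S)>0$ such that for every trigonometric polynomial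 $f(\theta)=\sum_{k\in S}a_k e^{2\pi i k\cdot\theta}$ with complex coefficients, $$\mathbf{Error}_N=\mathcal{O}\left(\exp\left(-c_{\rm III}\sqrt N\right)\right).$$ -/

import Mathlib

open Set Filter Topology MeasureTheory

noncomputable section

namespace WeightedBirkhoff

/-- The exponential weighting function: `exp (-1 / (x (1 - x)))` on `(0, 1)`, normalized to have
integral one, and zero outside `(0, 1)`. -/
def weight (x : ℝ) : ℝ :=
  if x ∈ Ioo (0 : ℝ) 1 then
    (∫ s in (0 : ℝ)..1, Real.exp (-(s⁻¹ * (1 - s)⁻¹)))⁻¹ * Real.exp (-(x⁻¹ * (1 - x)⁻¹))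
  else 0

/-- The normalizing factor `A_N = ∑_{n < N} w (n / N)`. It is positive for `N ≥ 2`. -/
def weightSum (N : ℕ) : ℝ := ∑ n ∈ Finset.range N, weight ((n : ℝ) / N)

/-- The rotation `θ ↦ θ + ρ mod 1` of the torus `ℝ^d / ℤ^d`. -/
def rotation {d : ℕ} (ρ : UnitAddTorus (Fin d)) (θ : UnitAddTorus (Fin d)) :
    UnitAddTorus (Fin d) := θ + ρ

/-- The weighted Birkhoff average of `f` along the first `N` points of the orbit of `θ`. -/
def weightedAverage {d : ℕ} (f : UnitAddTorus (Fin d) → ℂ) (ρ : UnitAddTorus (Fin d)) (N : ℕ)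
    (θ : UnitAddTorus (Fin d)) : ℂ :=
  (weightSum N : ℂ)⁻¹ *
    ∑ n ∈ Finset.range N, (weight ((n : ℝ) / N) : ℂ) * f ((rotation ρ)^[n] θ)

/-- The distance of the weighted Birkhoff average from the space average. The integral is over the
torus with its normalized Haar (Lebesgue) measure. -/
def birkhoffError {d : ℕ} (f : UnitAddTorus (Fin d) → ℂ) (ρ : UnitAddTorus (Fin d)) (N : ℕ)
    (θ : UnitAddTorus (Fin d)) : ℝ :=
  ‖weightedAverage f ρ N θ - ∫ x, f x‖

/-- The error is `O (g N)` as `N → ∞`, uniformly with respect to the initial point. -/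
def ErrorIsBigO {d : ℕ} (f : UnitAddTorus (Fin d) → ℂ) (ρ : UnitAddTorus (Fin d))
    (g : ℕ → ℝ) : Prop :=
  ∃ K : ℝ, ∀ᶠ N : ℕ in atTop, ∀ θ : UnitAddTorus (Fin d), birkhoffError f ρ N θ ≤ K * g N

/-- The projection `ℝ^d → ℝ^d / ℤ^d`. -/
def toTorus {d : ℕ} (x : Fin d → ℝ) : UnitAddTorus (Fin d) := fun j => (x j : UnitAddCircle)

/-- A function on the torus is (real) analytic if its lift to `ℝ^d` is. -/
def IsAnalytic {d : ℕ} (f : UnitAddTorus (Fin d) → ℂ) : Prop :=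
  AnalyticOnNhd ℝ (fun x : Fin d → ℝ => f (toTorus x)) univ

/-- The lift of `f` is, around every point of `ℝ^d`, the sum of a power series on the ball of
radius `r` (`r` is a lower bound for the radius of analyticity of `f`). -/
def HasAnalyticRadius {d : ℕ} (f : UnitAddTorus (Fin d) → ℂ) (r : ℝ) : Prop :=
  ∀ x : Fin d → ℝ, ∃ p : FormalMultilinearSeries ℝ (Fin d → ℝ) ℂ,
    HasFPowerSeriesOnBall (fun y : Fin d → ℝ => f (toTorus y)) p x (ENNReal.ofReal r)

/-- The nonresonance condition with exponent `d` and constant `C`, where `|k| = ∑ |k_j|`. The norm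
of `UnitAddCircle` is the distance to the nearest integer. -/
def IsDiophantine {d : ℕ} (ρ : UnitAddTorus (Fin d)) (C : ℝ) : Prop :=
  ∀ k : Fin d → ℤ, k ≠ 0 → C / (∑ j, |(k j : ℝ)|) ^ d < ‖∑ j, k j • ρ j‖

/-- The trigonometric polynomial `∑_{k ∈ S} a_k exp (2 π i k · θ)`. -/
def trigPoly {d : ℕ} (S : Finset (Fin d → ℤ)) (a : (Fin d → ℤ) → ℂ)
    (θ : UnitAddTorus (Fin d)) : ℂ :=
  ∑ k ∈ S, a k * UnitAddTorus.mFourier k θ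

/-- The Diophantine condition in terms of a representative of the rotation in `ℝ^d`. -/
theorem isDiophantine_toTorus_iff {d : ℕ} (ρ : Fin d → ℝ) (C : ℝ) :
    IsDiophantine (toTorus ρ) C ↔ ∀ k : Fin d → ℤ, k ≠ 0 → ∀ n : ℤ,
      C / (∑ j, |(k j : ℝ)|) ^ d < |(∑ j, (k j : ℝ) * ρ j) - n| := by
  have key : ∀ k : Fin d → ℤ, (∑ j, k j • toTorus ρ j) =
      ((∑ j, (k j : ℝ) * ρ j : ℝ) : UnitAddCircle) := by
    intro k
    have h1 : ∀ j, k j • toTorus ρ j =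
        QuotientAddGroup.mk' (AddSubgroup.zmultiples (1 : ℝ)) ((k j : ℝ) * ρ j) := by
      intro j
      rw [← zsmul_eq_mul, map_zsmul]
      rfl
    simp only [h1]
    rw [← map_sum]
    rfl
  refine forall_congr' fun k => forall_congr' fun _ => ?_
  rw [key, UnitAddCircle.norm_eq]
  exact ⟨fun h n => h.trans_le (round_le _ n), fun h => h _⟩

/-- A function on the torus is analytic if and only if it has a positive analyticity radius. -/
theorem isAnalytic_iff {d : ℕ} (f : UnitAddTorus (Fin d) → ℂ) :
    IsAnalytic f ↔ ∃ r : ℝ, 0 < r ∧ HasAnalyticRadius f r := by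
  constructor
  · intro hf
    have h0 : ∀ x : Fin d → ℝ, ∃ r : ℝ, 0 < r ∧
        ∃ p : FormalMultilinearSeries ℝ (Fin d → ℝ) ℂ,
          HasFPowerSeriesOnBall (fun y => f (toTorus y)) p x (ENNReal.ofReal (2 * r)) := by
      intro x
      obtain ⟨p, R, hp⟩ := hf x (mem_univ x)
      obtain ⟨s, hs0, hsR⟩ := ENNReal.lt_iff_exists_nnreal_btwn.1 hp.r_pos
      have hs : (0 : ℝ) < s := by exact_mod_cast hs0
      refine ⟨s / 2, by positivity, p, hp.mono ?_ ?_⟩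
      · simpa using hs
      · rw [mul_div_cancel₀ _ two_ne_zero, ENNReal.ofReal_coe_nnreal]
        exact hsR.le
    choose R hR p hp using h0
    obtain ⟨t, -, ht⟩ := (isCompact_Icc (a := (0 : Fin d → ℝ)) (b := 1)).elim_nhds_subcover
      (fun x => Metric.ball x (R x)) (fun x _ => Metric.ball_mem_nhds x (hR x))
    obtain ⟨r, hr, hrt⟩ : ∃ r : ℝ, 0 < r ∧ ∀ x ∈ t, r ≤ R x := by
      clear ht
      induction t using Finset.induction_on with
      | empty => exact ⟨1, one_pos, by simp⟩
      | insert a s _ ih =>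
        obtain ⟨r, hr, h⟩ := ih
        refine ⟨min r (R a), lt_min hr (hR a), fun x hx => ?_⟩
        rcases Finset.mem_insert.1 hx with rfl | hx
        · exact min_le_right _ _
        · exact (min_le_left _ _).trans (h x hx)
    refine ⟨r, hr, fun y => ?_⟩
    have hcube : ∀ y ∈ Icc (0 : Fin d → ℝ) 1,
        ∃ q : FormalMultilinearSeries ℝ (Fin d → ℝ) ℂ,
          HasFPowerSeriesOnBall (fun z => f (toTorus z)) q y (ENNReal.ofReal r) := by
      intro y hy
      obtain ⟨x, hxt, hx⟩ := mem_iUnion₂.1 (ht hy)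
      rw [Metric.mem_ball, dist_eq_norm] at hx
      have hlt : ‖y - x‖ < 2 * R x := by linarith [hR x]
      have h1 := (hp x).changeOrigin (y := y - x) (by
        rw [← ENNReal.ofReal_coe_nnreal, coe_nnnorm]
        exact (ENNReal.ofReal_lt_ofReal_iff (by linarith [hR x])).2 hlt)
      rw [add_sub_cancel] at h1
      refine ⟨_, h1.mono (by simpa using hr) ?_⟩
      rw [← ENNReal.ofReal_coe_nnreal, coe_nnnorm,
        ← ENNReal.ofReal_sub _ (norm_nonneg _)]
      exact ENNReal.ofReal_le_ofReal (by linarith [hrt x hxt])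
    let v : Fin d → ℝ := fun j => (⌊y j⌋ : ℝ)
    obtain ⟨q, hq⟩ := hcube (fun j => Int.fract (y j))
      ⟨fun j => Int.fract_nonneg _, fun j => (Int.fract_lt_one _).le⟩
    refine ⟨q, ?_⟩
    have h2 := hq.comp_sub v
    have hy : (fun j => Int.fract (y j)) + v = y := by
      funext j
      simp [v, Int.fract_add_floor]
    have hper : (fun z => f (toTorus (z - v))) = fun z => f (toTorus z) := by
      funext z
      congr 1
      funext j
      have : ((⌊y j⌋ : ℝ) : UnitAddCircle) = 0 :=
        (AddCircle.coe_eq_zero_iff (p := (1 : ℝ))).2 ⟨⌊y j⌋, by simp⟩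
      simp [toTorus, v, this]
    rw [hy, hper] at h2
    exact h2
  · rintro ⟨r, -, h⟩ x _
    obtain ⟨p, hp⟩ := h x
    exact hp.analyticAt

end WeightedBirkhoff

end

noncomputable section

namespace WeightedBirkhoff

open scoped Nat

variable {d : ℕ}

/-! Expanding `f` in its Fourier series turns the error into the modulus of `∑_{k ≠ 0} c_k W_N(k·ρ)
e^{2πi k·θ}`, where `W_N(x)` is the normalized weighted sum of `e^{2πi n x}` over `n < N`. The
frequency `k = 0` contributes exactly the space average, and characters have modulus one, so every
bound is uniform in `θ`.

The main estimate is `|W_N(x)| ≤ const · N · exp(-√(N‖x‖)/4)` (`norm_weightedExpSum_le`). The weight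
is Gevrey of order two: its `m`-th derivative is at most `18^m (m!)^2` up to normalization. Each
summation by parts gains `1/(N |e^{2πix} - 1|)` and costs one derivative. After `m` of them the sum
is at most a multiple of `N (18 m² / (4 N‖x‖))^m`, and `m ≈ √(N‖x‖)/4` is a good choice.

The coefficients `c_k` of an analytic `f` decay exponentially in `|k|`. Splitting the frequencies at
`|k| = X` gives, up to a factor `N`, `exp(-√(N D)/4) + exp(-l X)`, where `D` bounds the divisors
`‖k·ρ‖` with `|k| ≤ X` from below. The terms balance when `D` is of order `X²/N`. With `D ~ X^{-d}`
this is `X = N^{1/(d+2)}`; the logarithmic loss of almost every `ρ`, supplied by Borel–Cantelli,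
changes `X` by a power of `ln N`. A trigonometric polynomial has only finitely many divisors, so `D`
is constant and the rate is `√N`. -/

/-! ### Gevrey bounds for the weight -/

/-- Iterated derivatives of a holomorphic function along the real axis. -/
theorem iteratedDeriv_comp_ofReal {U : Set ℂ} (hU : IsOpen U) (n : ℕ) {g : ℂ → ℂ}
    (hg : DifferentiableOn ℂ g U) {x : ℝ} (hx : (x : ℂ) ∈ U) :
    iteratedDeriv n (fun t : ℝ => g t) x = iteratedDeriv n g x := by
  induction n generalizing g with
  | zero => simp
  | succ n ih =>
    rw [iteratedDeriv_succ', iteratedDeriv_succ', ← ih (hg.deriv hU)]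
    refine Filter.EventuallyEq.iteratedDeriv_eq n ?_
    filter_upwards [(hU.preimage Complex.continuous_ofReal).mem_nhds hx] with t ht
    exact ((hg.differentiableAt (hU.mem_nhds ht)).hasDerivAt.comp_ofReal).deriv

theorem norm_iteratedDeriv_ofReal {f : ℝ → ℝ} {x : ℝ} {n : ℕ} (hf : ContDiffAt ℝ n f x) :
    ‖iteratedDeriv n (fun t => (f t : ℂ)) x‖ = ‖iteratedDeriv n f x‖ := by
  have := Complex.ofRealLI.norm_iteratedFDeriv_comp_left hf le_rfl
  rwa [norm_iteratedFDeriv_eq_norm_iteratedDeriv, norm_iteratedFDeriv_eq_norm_iteratedDeriv] at this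

/-- The smooth function `exp (-1 / x)` belongs to the Gevrey class of order two. -/
theorem norm_iteratedDeriv_expNegInvGlue_le (n : ℕ) (x : ℝ) :
    ‖iteratedDeriv n expNegInvGlue x‖ ≤ 9 ^ n * (n ! : ℝ) ^ 2 := by
  have hsmooth : ContDiff ℝ n expNegInvGlue := expNegInvGlue.contDiff (n := (n : ℕ∞))
  have hclosed : IsClosed {x : ℝ | ‖iteratedDeriv n expNegInvGlue x‖ ≤ 9 ^ n * (n ! : ℝ) ^ 2} :=
    isClosed_le (hsmooth.continuous_iteratedDeriv n le_rfl).norm continuous_const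
  -- The Cauchy estimate degenerates at the singularity `0`, but the bound is a closed condition, so
  -- the dense set `x ≠ 0` suffices.
  refine hclosed.closure_subset_iff.2 ?_ ((dense_compl_singleton (0 : ℝ)) x)
  intro x hx
  rcases lt_or_gt_of_ne (show x ≠ 0 from hx) with hx | hx
  · have : expNegInvGlue =ᶠ[𝓝 x] fun _ => 0 := by
      filter_upwards [gt_mem_nhds hx] with y hy
      exact expNegInvGlue.zero_of_nonpos hy.le
    rw [mem_ofPred_eq, this.iteratedDeriv_eq n]
    have h0 : iteratedDeriv n (fun _ : ℝ => (0 : ℝ)) x = 0 := by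
      simp
    rw [h0, norm_zero]
    positivity
  · rw [mem_ofPred_eq, ← norm_iteratedDeriv_ofReal hsmooth.contDiffAt]
    have hU : IsOpen {z : ℂ | 0 < z.re} := isOpen_lt continuous_const Complex.continuous_re
    have hd : DifferentiableOn ℂ (fun z : ℂ => Complex.exp (-z⁻¹)) {z : ℂ | 0 < z.re} := by
      intro z hz
      have : z ≠ 0 := by
        rintro rfl
        simp at hz
      exact ((differentiableAt_inv this).neg.cexp).differentiableWithinAt
    have he : (fun t : ℝ => (expNegInvGlue t : ℂ)) =ᶠ[𝓝 x]
        fun t : ℝ => (fun z : ℂ => Complex.exp (-z⁻¹)) t := by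
      filter_upwards [lt_mem_nhds hx] with y hy
      simp [expNegInvGlue, hy.not_ge]
    rw [he.iteratedDeriv_eq n, iteratedDeriv_comp_ofReal hU n hd (by simpa using hx)]
    have hre : ∀ z ∈ Metric.closedBall (x : ℂ) (x / 2), x / 2 ≤ z.re ∧ ‖z‖ ≤ 3 * x / 2 := by
      intro z hz
      rw [mem_closedBall_iff_norm] at hz
      constructor
      · have := (Complex.abs_re_le_norm (z - x)).trans hz
        rw [Complex.sub_re, Complex.ofReal_re, abs_le] at this
        linarith [this.1]
      · have := norm_add_le (z - x) (x : ℂ)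
        rw [sub_add_cancel, Complex.norm_real, Real.norm_eq_abs, abs_of_pos hx] at this
        linarith
    have hcl : closure (Metric.ball (x : ℂ) (x / 2)) ⊆ {z : ℂ | 0 < z.re} := by
      intro z hz
      have := (hre z (Metric.closure_ball_subset_closedBall hz)).1
      exact lt_of_lt_of_le (by linarith) this
    -- Cauchy's estimate on the disc of radius `x/2`. There `Re (1/z) = Re z / |z|² ≥ (x/2) /
    -- (3x/2)² = 2/(9x)`. This exponential smallness then pays for the factor `(x/2)^(-n)` at the
    -- price of a second `n!`.
    have hC := Complex.norm_iteratedDeriv_le_of_forall_mem_sphere_norm_le (c := (x : ℂ))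
      (R := x / 2) (C := Real.exp (-(2 / (9 * x)))) n (by linarith)
      (hd.mono hcl).diffContOnCl (by
        intro z hz
        obtain ⟨h1, h2⟩ := hre z (Metric.sphere_subset_closedBall hz)
        have hz0 : 0 < Complex.normSq z := by
          rw [Complex.normSq_pos]
          rintro rfl
          simp at h1
          linarith
        rw [Complex.norm_exp, Complex.neg_re, Complex.inv_re]
        refine Real.exp_le_exp.2 (neg_le_neg ?_)
        rw [div_le_div_iff₀ (by positivity) hz0, Complex.normSq_eq_norm_sq]
        nlinarith [norm_nonneg z])
    refine hC.trans ?_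
    have hexp := Real.pow_div_factorial_le_exp (2 / (9 * x)) (by positivity) n
    rw [div_le_iff₀ (by positivity)] at hexp
    have key : 1 / (x / 2) ^ n = 9 ^ n * (2 / (9 * x)) ^ n := by
      rw [← mul_pow, ← one_div_pow]
      congr 1
      field_simp
    calc (n ! : ℝ) * Real.exp (-(2 / (9 * x))) / (x / 2) ^ n
        = (n ! : ℝ) * Real.exp (-(2 / (9 * x))) * (9 ^ n * (2 / (9 * x)) ^ n) := by
          rw [← key]
          ring
      _ ≤ (n ! : ℝ) * Real.exp (-(2 / (9 * x))) * (9 ^ n * (Real.exp (2 / (9 * x)) * n !)) := by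
          gcongr
      _ = 9 ^ n * (n ! : ℝ) ^ 2 := by
          rw [Real.exp_neg]
          field_simp

/-- The weight without its normalizing constant. -/
def bump (x : ℝ) : ℝ := expNegInvGlue x * expNegInvGlue (1 - x)

theorem contDiff_bump (n : ℕ∞) : ContDiff ℝ n bump :=
  expNegInvGlue.contDiff.mul (expNegInvGlue.contDiff.comp (contDiff_const.sub contDiff_id))

theorem bump_nonneg (x : ℝ) : 0 ≤ bump x :=
  mul_nonneg (expNegInvGlue.nonneg _) (expNegInvGlue.nonneg _)

theorem bump_of_nonpos {x : ℝ} (hx : x ≤ 0) : bump x = 0 := by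
  simp [bump, expNegInvGlue.zero_of_nonpos hx]

theorem bump_of_one_le {x : ℝ} (hx : 1 ≤ x) : bump x = 0 := by
  simp [bump, expNegInvGlue.zero_of_nonpos (sub_nonpos.2 hx)]

theorem bump_of_mem_Ioo {x : ℝ} (hx : x ∈ Ioo (0 : ℝ) 1) :
    bump x = Real.exp (-(x⁻¹ * (1 - x)⁻¹)) := by
  have h1 : (1 - x) ≠ 0 := (sub_pos.2 hx.2).ne'
  have h0 : x ≠ 0 := hx.1.ne'
  rw [bump, expNegInvGlue, expNegInvGlue, if_neg hx.1.not_ge, if_neg (sub_pos.2 hx.2).not_ge,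
    ← Real.exp_add]
  congr 1
  field_simp
  ring

theorem iteratedDeriv_bump_eq_zero (n : ℕ) {x : ℝ} (hx : x < 0 ∨ 1 < x) :
    iteratedDeriv n bump x = 0 := by
  have : bump =ᶠ[𝓝 x] fun _ => 0 := by
    rcases hx with hx | hx
    · filter_upwards [gt_mem_nhds hx] with y hy using bump_of_nonpos hy.le
    · filter_upwards [lt_mem_nhds hx] with y hy using bump_of_one_le hy.le
  rw [this.iteratedDeriv_eq n]
  simp

/-- By Leibniz each term is at most `9^n` times `C(n,i) (i!)² ((n-i)!)² = n! · i! (n-i)! ≤ (n!)²`,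
and there are `n + 1 ≤ 2^n` terms. -/
theorem norm_iteratedDeriv_bump_le (n : ℕ) (x : ℝ) :
    ‖iteratedDeriv n bump x‖ ≤ 18 ^ n * (n ! : ℝ) ^ 2 := by
  have h1 : ContDiffAt ℝ n expNegInvGlue x :=
    (expNegInvGlue.contDiff (n := (n : ℕ∞))).contDiffAt
  have h2 : ContDiffAt ℝ n (fun x => expNegInvGlue (1 - x)) x :=
    ((expNegInvGlue.contDiff (n := (n : ℕ∞))).comp (contDiff_const.sub contDiff_id)).contDiffAt
  have := iteratedDeriv_mul h1 h2
  change ‖iteratedDeriv n (expNegInvGlue * fun x => expNegInvGlue (1 - x)) x‖ ≤ _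
  rw [this]
  refine (norm_sum_le _ _).trans ?_
  have hterm : ∀ i ∈ Finset.range (n + 1),
      ‖(n.choose i : ℝ) * iteratedDeriv i expNegInvGlue x *
        iteratedDeriv (n - i) (fun x => expNegInvGlue (1 - x)) x‖ ≤ 9 ^ n * (n ! : ℝ) ^ 2 := by
    intro i hi
    have hi' : i ≤ n := Nat.lt_succ_iff.1 (Finset.mem_range.1 hi)
    rw [iteratedDeriv_comp_const_sub, norm_mul, norm_mul, norm_smul, norm_pow, norm_neg, norm_one,
      one_pow, one_mul, Real.norm_natCast]
    have e : (n.choose i : ℝ) * i ! * (n - i)! = n ! := by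
      exact_mod_cast Nat.choose_mul_factorial_mul_factorial hi'
    have e2 : (i ! : ℝ) * (n - i)! ≤ n ! := by
      rw [← e]
      have : (1 : ℝ) ≤ n.choose i := by exact_mod_cast Nat.choose_pos hi'
      have h3 : (0 : ℝ) ≤ (i ! : ℝ) * (n - i)! := by positivity
      nlinarith
    calc (n.choose i : ℝ) * ‖iteratedDeriv i expNegInvGlue x‖ *
          ‖iteratedDeriv (n - i) expNegInvGlue (1 - x)‖
        ≤ (n.choose i : ℝ) * (9 ^ i * (i ! : ℝ) ^ 2) * (9 ^ (n - i) * ((n - i)! : ℝ) ^ 2) := by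
          gcongr <;> exact norm_iteratedDeriv_expNegInvGlue_le _ _
      _ = (9 ^ i * 9 ^ (n - i)) * ((n.choose i : ℝ) * i ! * (n - i)!) * (i ! * (n - i)!) := by ring
      _ = 9 ^ n * n ! * (i ! * (n - i)!) := by rw [e, ← pow_add, Nat.add_sub_cancel' hi']
      _ ≤ 9 ^ n * n ! * n ! := by gcongr
      _ = 9 ^ n * (n ! : ℝ) ^ 2 := by ring
  refine (Finset.sum_le_card_nsmul _ _ _ hterm).trans ?_
  have h2n : ((n + 1 : ℕ) : ℝ) ≤ 2 ^ n := by exact_mod_cast Nat.lt_two_pow_self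
  rw [Finset.card_range, nsmul_eq_mul]
  calc ((n + 1 : ℕ) : ℝ) * (9 ^ n * (n ! : ℝ) ^ 2) ≤ 2 ^ n * (9 ^ n * (n ! : ℝ) ^ 2) := by gcongr
    _ = 18 ^ n * (n ! : ℝ) ^ 2 := by
      rw [← mul_assoc, ← mul_pow]
      norm_num

/-! ### Decay of twisted sums by repeated summation by parts -/

/-- The periodized twisted sum `∑ (d/ds)^m w (n / N + s) z ^ n` (with `n` shifted by `3`). -/
def twistedSum (N : ℕ) (z : ℂ) (m : ℕ) (s : ℝ) : ℂ :=
  ∑ n ∈ Finset.range (N + 5), ((iteratedDeriv m bump (((n : ℝ) - 3) / N + s) : ℝ) : ℂ) * z ^ n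

theorem hasDerivAt_twistedSum (N : ℕ) (z : ℂ) (m : ℕ) (s : ℝ) :
    HasDerivAt (twistedSum N z m) (twistedSum N z (m + 1) s) s := by
  refine HasDerivAt.fun_sum fun n _ => ?_
  refine HasDerivAt.mul_const ?_ _
  rw [iteratedDeriv_succ]
  have hd : Differentiable ℝ (iteratedDeriv m bump) :=
    (contDiff_bump ⊤).differentiable_iteratedDeriv m (by exact_mod_cast WithTop.coe_lt_top _)
  exact (((hd _).hasDerivAt).comp_const_add _ _).ofReal_comp

theorem norm_twistedSum_le {z : ℂ} (hz : ‖z‖ = 1) (N m : ℕ) (s : ℝ) :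
    ‖twistedSum N z m s‖ ≤ (N + 5) * (18 ^ m * (m ! : ℝ) ^ 2) := by
  refine (norm_sum_le_of_le (f := fun n : ℕ =>
    ((iteratedDeriv m bump (((n : ℝ) - 3) / N + s) : ℝ) : ℂ) * z ^ n) _
    (n := fun _ => 18 ^ m * (m ! : ℝ) ^ 2) fun n _ => ?_).trans ?_
  · rw [norm_mul, norm_pow, hz, one_pow, mul_one, Complex.norm_real]
    exact norm_iteratedDeriv_bump_le _ _
  · simp

/-- Moving `s` by `1/N` shifts the index by one, hence quasi-periodicity. The unmatched end terms
sit at `-3/N + s < 0` and `1 + 2/N + s > 1`, where all derivatives vanish; the padding of the index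
range makes both inequalities strict. -/
theorem twistedSum_add_inv_mul {N : ℕ} (hN : 0 < N) (z : ℂ) (m : ℕ) {s : ℝ} (h0 : 0 ≤ s)
    (h1 : s ≤ 2 / N) : twistedSum N z m (s + 1 / N) * z = twistedSum N z m s := by
  have hN' : (0 : ℝ) < N := by exact_mod_cast hN
  rw [twistedSum, twistedSum, Finset.sum_range_succ, Finset.sum_range_succ' _ (N + 4), add_mul,
    Finset.sum_mul]
  congr 1
  · refine Finset.sum_congr rfl fun n _ => ?_
    have : ((n : ℝ) - 3) / N + (s + 1 / N) = (((n + 1 : ℕ) : ℝ) - 3) / N + s := by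
      push_cast
      ring
    rw [this, pow_succ]
    ring
  · rw [iteratedDeriv_bump_eq_zero, iteratedDeriv_bump_eq_zero]
    · simp
    · left
      have : 2 / (N : ℝ) < 3 / N := by gcongr; norm_num
      simp only [Nat.cast_zero, zero_sub, neg_div]
      linarith
    · right
      have : ((N + 4 : ℕ) - 3 : ℝ) / N + (s + 1 / N) = 1 + 2 / N + s := by
        push_cast
        field_simp
        ring
      rw [this]
      have : (0 : ℝ) < 2 / N := by positivity
      linarith

/-- By quasi-periodicity the increment over a step `1/N` has norm `‖z - 1‖` times that of the sum
itself, while the mean value inequality bounds it by `M/N`. The interval `[0, 2/N]` holds two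
periods, so every point is an end of such a step and the conclusion holds on the same interval,
ready for iteration. -/
theorem norm_twistedSum_le_of_deriv {N : ℕ} (hN : 0 < N) {z : ℂ} (hz : ‖z‖ = 1) (hz1 : z ≠ 1)
    {m : ℕ} {M : ℝ} (hM : ∀ s ∈ Icc (0 : ℝ) (2 / N), ‖twistedSum N z (m + 1) s‖ ≤ M) :
    ∀ s ∈ Icc (0 : ℝ) (2 / N), ‖twistedSum N z m s‖ ≤ 1 / (N * ‖z - 1‖) * M := by
  have hN' : (0 : ℝ) < N := by exact_mod_cast hN
  have hz' : 0 < ‖z - 1‖ := norm_pos_iff.2 (sub_ne_zero.2 hz1)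
  have h2 : (2 : ℝ) / N = 1 / N + 1 / N := by ring
  have hpos : (0 : ℝ) < 1 / N := by positivity
  have main : ∀ s ∈ Icc (0 : ℝ) (1 / N),
      ‖twistedSum N z m s‖ ≤ 1 / (N * ‖z - 1‖) * M ∧
        ‖twistedSum N z m (s + 1 / N)‖ ≤ 1 / (N * ‖z - 1‖) * M := by
    intro s hs
    have hq := twistedSum_add_inv_mul hN z m hs.1 (by linarith [hs.2])
    have hnorm : ‖twistedSum N z m s‖ = ‖twistedSum N z m (s + 1 / N)‖ := by
      rw [← hq, norm_mul, hz, mul_one]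
    have hmv := Convex.norm_image_sub_le_of_norm_hasDerivWithin_le (f := twistedSum N z m)
      (s := Icc (0 : ℝ) (2 / N)) (x := s) (y := s + 1 / N)
      (fun x _ => (hasDerivAt_twistedSum N z m x).hasDerivWithinAt) hM (convex_Icc _ _)
      ⟨hs.1, by linarith [hs.2]⟩ ⟨by linarith [hs.1], by linarith [hs.2]⟩
    have e : ‖twistedSum N z m (s + 1 / N) - twistedSum N z m s‖ =
        ‖twistedSum N z m (s + 1 / N)‖ * ‖z - 1‖ := by
      have : twistedSum N z m (s + 1 / N) - twistedSum N z m s =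
          -(twistedSum N z m (s + 1 / N) * (z - 1)) := by
        rw [← hq]
        ring
      rw [this, norm_neg, norm_mul]
    rw [e, add_sub_cancel_left, Real.norm_of_nonneg hpos.le] at hmv
    have : ‖twistedSum N z m (s + 1 / N)‖ ≤ 1 / (N * ‖z - 1‖) * M := by
      rw [← le_div_iff₀ hz'] at hmv
      refine hmv.trans_eq ?_
      field_simp
    exact ⟨hnorm ▸ this, this⟩
  intro s hs
  rcases le_total s (1 / N) with h | h
  · exact (main s ⟨hs.1, h⟩).1
  · have := (main (s - 1 / N) ⟨by linarith, by linarith [hs.2]⟩).2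
    rwa [sub_add_cancel] at this

theorem norm_twistedSum_le_pow {N : ℕ} (hN : 0 < N) {z : ℂ} (hz : ‖z‖ = 1) (hz1 : z ≠ 1)
    (j m : ℕ) : ∀ s ∈ Icc (0 : ℝ) (2 / N), ‖twistedSum N z m s‖ ≤
      (1 / (N * ‖z - 1‖)) ^ j * ((N + 5) * (18 ^ (m + j) * ((m + j)! : ℝ) ^ 2)) := by
  induction j generalizing m with
  | zero =>
    intro s _
    simpa using norm_twistedSum_le hz N m s
  | succ j ih =>
    intro s hs
    refine (norm_twistedSum_le_of_deriv hN hz hz1 (ih (m + 1)) s hs).trans_eq ?_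
    rw [pow_succ, show m + 1 + j = m + (j + 1) by ring]
    ring

theorem twistedSum_zero_zero {N : ℕ} (hN : 0 < N) (z : ℂ) :
    twistedSum N z 0 0 = z ^ 3 * ∑ n ∈ Finset.range N, (bump ((n : ℝ) / N) : ℂ) * z ^ n := by
  have hN' : (0 : ℝ) < N := by exact_mod_cast hN
  rw [twistedSum, show N + 5 = 3 + (N + 2) by ring, Finset.sum_range_add, Finset.sum_eq_zero,
    zero_add, Finset.sum_range_succ, Finset.sum_range_succ, Finset.mul_sum]
  · have e1 : bump (((3 + N : ℕ) - 3 : ℝ) / N + 0) = 0 := by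
      refine bump_of_one_le ?_
      push_cast
      rw [add_sub_cancel_left, div_self hN'.ne', add_zero]
    have e2 : bump (((3 + (N + 1) : ℕ) - 3 : ℝ) / N + 0) = 0 := by
      refine bump_of_one_le ?_
      push_cast
      rw [add_sub_cancel_left, add_zero, le_div_iff₀ hN']
      linarith
    rw [iteratedDeriv_zero, e1, e2]
    simp only [Complex.ofReal_zero, zero_mul, add_zero]
    refine Finset.sum_congr rfl fun n _ => ?_
    push_cast
    rw [add_sub_cancel_left, pow_add]
    ring
  · intro n hn
    have hn : (n : ℝ) ≤ 3 := by exact_mod_cast (Finset.mem_range.1 hn).le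
    rw [iteratedDeriv_zero, bump_of_nonpos]
    · simp
    · rw [add_zero]
      exact div_nonpos_of_nonpos_of_nonneg (by linarith) hN'.le

theorem norm_sum_bump_mul_pow_le {N : ℕ} (hN : 0 < N) {z : ℂ} (hz : ‖z‖ = 1) (hz1 : z ≠ 1)
    (m : ℕ) : ‖∑ n ∈ Finset.range N, (bump ((n : ℝ) / N) : ℂ) * z ^ n‖ ≤
      (N + 5) * (18 * (m : ℝ) ^ 2 / (N * ‖z - 1‖)) ^ m := by
  have hN' : (0 : ℝ) < N := by exact_mod_cast hN
  have h := norm_twistedSum_le_pow hN hz hz1 m 0 0 ⟨le_rfl, by positivity⟩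
  rw [twistedSum_zero_zero hN, norm_mul, norm_pow, hz, one_pow, one_mul, zero_add] at h
  refine h.trans ?_
  have hf : (m ! : ℝ) ≤ (m : ℝ) ^ m := by exact_mod_cast Nat.factorial_le_pow m
  calc (1 / (N * ‖z - 1‖)) ^ m * ((N + 5) * (18 ^ m * (m ! : ℝ) ^ 2))
      ≤ (1 / (N * ‖z - 1‖)) ^ m * ((N + 5) * (18 ^ m * ((m : ℝ) ^ m) ^ 2)) := by gcongr
    _ = (N + 5) * (18 * (m : ℝ) ^ 2 / (N * ‖z - 1‖)) ^ m := by
      rw [← pow_mul, mul_comm m 2, pow_mul, div_pow, mul_pow, div_pow, mul_pow, mul_pow, one_pow]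
      ring

/-- With `t` the signed distance to the nearest integer, `|e^{2πit} - 1| = 2 |sin πt| ≥ 4|t|` by
Jordan's inequality, as `|t| ≤ 1/2`. -/
theorem four_mul_norm_le_norm_toCircle_sub_one (x : UnitAddCircle) :
    4 * ‖x‖ ≤ ‖(x.toCircle : ℂ) - 1‖ := by
  obtain ⟨y, rfl⟩ := QuotientAddGroup.mk_surjective x
  have hy : ((y - round y : ℝ) : UnitAddCircle) = (y : UnitAddCircle) := by
    have : ((round y : ℝ) : UnitAddCircle) = 0 :=
      (AddCircle.coe_eq_zero_iff (p := (1 : ℝ))).2 ⟨round y, by simp⟩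
    rw [AddCircle.coe_sub, this, sub_zero]
  change 4 * ‖(y : UnitAddCircle)‖ ≤ ‖(AddCircle.toCircle (y : UnitAddCircle) : ℂ) - 1‖
  rw [UnitAddCircle.norm_eq, ← hy, AddCircle.toCircle_apply_mk, Circle.coe_exp]
  set t := y - round y with ht
  have h12 : |t| ≤ 1 / 2 := abs_sub_round y
  have hpi := Real.pi_pos
  have e : ((2 * Real.pi / 1 * t : ℝ) : ℂ) * Complex.I = Complex.I * ((2 * Real.pi * t : ℝ)) := by
    push_cast
    ring
  rw [e, Complex.norm_exp_I_mul_ofReal_sub_one, norm_mul, Real.norm_ofNat, Real.norm_eq_abs,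
    show 2 * Real.pi * t / 2 = Real.pi * t by ring]
  have hs := Real.mul_abs_le_abs_sin (x := Real.pi * t) (by
    rw [abs_mul, abs_of_pos hpi]
    nlinarith)
  rw [abs_mul, abs_of_pos hpi, ← mul_assoc, div_mul_cancel₀ _ hpi.ne'] at hs
  linarith

theorem norm_sum_bump_mul_toCircle_pow_le {N : ℕ} (hN : 0 < N) (x : UnitAddCircle) :
    ‖∑ n ∈ Finset.range N, (bump ((n : ℝ) / N) : ℂ) * (x.toCircle : ℂ) ^ n‖ ≤
      6 * Real.exp 1 * N * Real.exp (-(√(N * ‖x‖) / 4)) := by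
  have hN' : (0 : ℝ) < N := by exact_mod_cast hN
  have hN1 : (1 : ℝ) ≤ N := by exact_mod_cast hN
  by_cases hx : x = 0
  · subst hx
    refine (norm_sum_le_of_le (n := fun _ => (1 : ℝ)) _ fun n _ => ?_).trans ?_
    · have := norm_iteratedDeriv_bump_le 0 ((n : ℝ) / N)
      simpa using this
    · have : (1 : ℝ) ≤ Real.exp 1 := by simp
      simp
      nlinarith
  · have hx0 : 0 < ‖x‖ := norm_pos_iff.2 hx
    have h4 := four_mul_norm_le_norm_toCircle_sub_one x
    have hz1 : (x.toCircle : ℂ) ≠ 1 := by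
      intro h
      rw [h, sub_self, norm_zero] at h4
      linarith
    -- Taking `m = ⌊y⌋` derivatives makes the base at most `18/64 < 1/e`; rounding down costs only a
    -- factor `e`.
    set y := √(N * ‖x‖) / 4 with hy
    have hy0 : 0 ≤ y := by positivity
    have hy2 : y ^ 2 = N * ‖x‖ / 16 := by
      rw [hy, div_pow, Real.sq_sqrt (by positivity)]
      norm_num
    set m := ⌊y⌋₊ with hm
    have hmy : (m : ℝ) ≤ y := Nat.floor_le hy0
    have hym : y < m + 1 := Nat.lt_floor_add_one y
    refine (norm_sum_bump_mul_pow_le hN (Circle.norm_coe _) hz1 m).trans ?_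
    have hbase : 18 * (m : ℝ) ^ 2 / (N * ‖(x.toCircle : ℂ) - 1‖) ≤ Real.exp (-1) := by
      have hexp : (18 : ℝ) / 64 ≤ Real.exp (-1) := by
        have := Real.exp_one_lt_d9
        rw [Real.exp_neg, le_inv_comm₀ (by norm_num) (Real.exp_pos _)]
        norm_num at this ⊢
        linarith
      refine le_trans ?_ hexp
      rw [div_le_div_iff₀ (by nlinarith) (by norm_num)]
      have : (m : ℝ) ^ 2 ≤ y ^ 2 := by gcongr
      nlinarith
    have h5 : (N : ℝ) + 5 ≤ 6 * N := by linarith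
    calc (N + 5) * (18 * (m : ℝ) ^ 2 / (N * ‖(x.toCircle : ℂ) - 1‖)) ^ m
        ≤ 6 * N * (Real.exp (-1)) ^ m := by gcongr
      _ = 6 * N * Real.exp (-m) := by rw [← Real.exp_nat_mul]; simp
      _ ≤ 6 * N * Real.exp (1 + -y) := by gcongr; linarith
      _ = 6 * Real.exp 1 * N * Real.exp (-y) := by rw [Real.exp_add]; ring

/-! ### Normalization of the weighted sums -/

theorem weight_eq_mul_bump (x : ℝ) :
    weight x = (∫ s in (0 : ℝ)..1, Real.exp (-(s⁻¹ * (1 - s)⁻¹)))⁻¹ * bump x := by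
  rw [weight]
  split_ifs with h
  · rw [bump_of_mem_Ioo h]
  · rw [mem_Ioo, not_and_or, not_lt, not_lt] at h
    rcases h with h | h
    · rw [bump_of_nonpos h, mul_zero]
    · rw [bump_of_one_le h, mul_zero]

theorem integral_weight_pos : 0 < ∫ s in (0 : ℝ)..1, Real.exp (-(s⁻¹ * (1 - s)⁻¹)) := by
  refine intervalIntegral.intervalIntegral_pos_of_pos_on ?_ (fun s _ => Real.exp_pos _) one_pos
  rw [intervalIntegrable_iff_integrableOn_Ioo_of_le zero_le_one]
  refine IntegrableOn.congr_fun (f := bump) ?_ (fun s hs => bump_of_mem_Ioo hs) measurableSet_Ioo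
  exact ((contDiff_bump ⊤).continuous.integrableOn_Icc).mono_set Ioo_subset_Icc_self

/-- The single term `n = ⌊N/2⌋` suffices: `n/N` lies in `[1/3, 1/2]`, so `x(1-x) ≥ 2/9 > 1/5`. -/
theorem exp_neg_five_le_sum_bump {N : ℕ} (hN : 2 ≤ N) :
    Real.exp (-5) ≤ ∑ n ∈ Finset.range N, bump ((n : ℝ) / N) := by
  have hN' : (0 : ℝ) < N := by exact_mod_cast (by omega : 0 < N)
  have hmem : N / 2 ∈ Finset.range N := Finset.mem_range.2 (by omega)
  refine le_trans ?_ (Finset.single_le_sum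
    (f := fun n : ℕ => bump ((n : ℝ) / N)) (fun n _ => bump_nonneg _) hmem)
  set x : ℝ := ((N / 2 : ℕ) : ℝ) / N with hx
  have h1 : (1 : ℝ) / 3 ≤ x := by
    rw [hx, div_le_div_iff₀ (by norm_num) hN']
    exact_mod_cast (by omega : 1 * N ≤ N / 2 * 3)
  have h2 : x ≤ 1 / 2 := by
    rw [hx, div_le_div_iff₀ hN' (by norm_num)]
    exact_mod_cast (by omega : N / 2 * 2 ≤ 1 * N)
  rw [bump_of_mem_Ioo ⟨by linarith, by linarith⟩]
  refine Real.exp_le_exp.2 (neg_le_neg ?_)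
  rw [← mul_inv, inv_le_comm₀ (by nlinarith) (by norm_num)]
  nlinarith

theorem weightSum_pos {N : ℕ} (hN : 2 ≤ N) : 0 < weightSum N := by
  rw [weightSum]
  simp_rw [weight_eq_mul_bump, ← Finset.mul_sum]
  exact mul_pos (inv_pos.2 integral_weight_pos)
    ((Real.exp_pos _).trans_le (exp_neg_five_le_sum_bump hN))

/-- The normalized weighted exponential sum. -/
def weightedExpSum (N : ℕ) (x : UnitAddCircle) : ℂ :=
  (weightSum N : ℂ)⁻¹ *
    ∑ n ∈ Finset.range N, (weight ((n : ℝ) / N) : ℂ) * (x.toCircle : ℂ) ^ n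

theorem weightedExpSum_zero {N : ℕ} (hN : 2 ≤ N) : weightedExpSum N 0 = 1 := by
  have := (weightSum_pos hN).ne'
  rw [weightedExpSum]
  simp only [AddCircle.toCircle_zero, Circle.coe_one, one_pow, mul_one]
  rw [← Complex.ofReal_sum, ← weightSum, inv_mul_cancel₀]
  exact_mod_cast this

/-- Weighted exponential sums decay like `exp (-c √(N ‖x‖))`. -/
theorem norm_weightedExpSum_le {N : ℕ} (hN : 2 ≤ N) (x : UnitAddCircle) :
    ‖weightedExpSum N x‖ ≤ 6 * Real.exp 6 * N * Real.exp (-(√(N * ‖x‖) / 4)) := by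
  have h1 := exp_neg_five_le_sum_bump hN
  have h2 := norm_sum_bump_mul_toCircle_pow_le (by omega : 0 < N) x
  have hI := integral_weight_pos
  set I := ∫ s in (0 : ℝ)..1, Real.exp (-(s⁻¹ * (1 - s)⁻¹)) with hIdef
  set B := ∑ n ∈ Finset.range N, bump ((n : ℝ) / N) with hB
  have hBpos : 0 < B := (Real.exp_pos _).trans_le h1
  have e : weightedExpSum N x = (B : ℂ)⁻¹ *
      ∑ n ∈ Finset.range N, (bump ((n : ℝ) / N) : ℂ) * (x.toCircle : ℂ) ^ n := by
    have hI' : (I : ℂ) ≠ 0 := by exact_mod_cast hI.ne'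
    rw [weightedExpSum, weightSum]
    simp_rw [weight_eq_mul_bump, ← hIdef, ← Finset.mul_sum, ← hB, Complex.ofReal_mul, mul_assoc,
      ← Finset.mul_sum]
    rw [Complex.ofReal_inv, mul_inv, inv_inv]
    field_simp
  rw [e, norm_mul, norm_inv, Complex.norm_real, Real.norm_of_nonneg hBpos.le]
  have h3 : B⁻¹ ≤ Real.exp 5 := by
    rw [inv_le_comm₀ hBpos (Real.exp_pos _), ← Real.exp_neg]
    exact h1
  refine (mul_le_mul h3 h2 (norm_nonneg _) (Real.exp_pos _).le).trans_eq ?_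
  rw [show (6 : ℝ) = 5 + 1 by norm_num, Real.exp_add]
  ring

/-! ### Uniform Taylor expansions of analytic functions on the torus -/

theorem isOpenQuotientMap_toTorus : IsOpenQuotientMap (toTorus (d := d)) :=
  IsOpenQuotientMap.piMap (f := fun _ : Fin d => ((↑) : ℝ → UnitAddCircle))
    fun _ => QuotientAddGroup.isOpenQuotientMap_mk

theorem toTorus_add (x y : Fin d → ℝ) : toTorus (x + y) = toTorus x + toTorus y := rfl

theorem HasAnalyticRadius.analyticOnNhd {f : UnitAddTorus (Fin d) → ℂ} {r : ℝ}
    (hf : HasAnalyticRadius f r) : AnalyticOnNhd ℝ (fun x : Fin d → ℝ => f (toTorus x)) univ :=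
  fun x _ => (hf x).choose_spec.analyticAt

theorem HasAnalyticRadius.continuous {f : UnitAddTorus (Fin d) → ℂ} {r : ℝ}
    (hf : HasAnalyticRadius f r) : Continuous f :=
  isOpenQuotientMap_toTorus.isQuotientMap.continuous_iff.2
    (continuousOn_univ.1 hf.analyticOnNhd.continuousOn)

theorem volume_unitAddCircle : (volume : Measure UnitAddCircle) = AddCircle.haarAddCircle := by
  rw [AddCircle.volume_eq_smul_haarAddCircle, ENNReal.ofReal_one, one_smul]

instance : IsProbabilityMeasure (volume : Measure UnitAddCircle) := by
  rw [volume_unitAddCircle]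
  infer_instance

theorem mFourierCoeff_eq (f : UnitAddTorus (Fin d) → ℂ) (k : Fin d → ℤ) :
    UnitAddTorus.mFourierCoeff f k = ∫ θ, UnitAddTorus.mFourier (-k) θ * f θ := by
  have : (volume : Measure (UnitAddTorus (Fin d))) =
      Measure.pi fun _ => AddCircle.haarAddCircle := by
    rw [← volume_unitAddCircle]
    rfl
  rw [this]
  rfl

/-- The coefficients of a power series recentred within a fixed distance of the origin are
uniformly bounded. -/
theorem exists_norm_changeOrigin_mul_pow_le {E F : Type*} [NormedAddCommGroup E] [NormedSpace ℝ E]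
    [NormedAddCommGroup F] [NormedSpace ℝ F] (p : FormalMultilinearSeries ℝ E F) {s : NNReal}
    (hs : ((s : ENNReal) + s) < p.radius) :
    ∃ M : NNReal, ∀ x : E, ‖x‖₊ ≤ s → ∀ n, ‖p.changeOrigin x n‖₊ * s ^ n ≤ M := by
  have hsum := (NNReal.summable_sigma.1 (p.changeOriginSeries_summable_aux₁ hs)).2
  simp only [NNReal.tsum_mul_right] at hsum
  -- The bound is the total of the double series for recentring with both radii `s`; a fixed `n` is
  -- one of its fibres.
  refine ⟨_, fun x hx n => le_trans ?_ (hsum.le_tsum n fun _ _ => zero_le)⟩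
  have hs' : (s : ENNReal) < p.radius := lt_of_le_of_lt le_self_add hs
  have hx' : (‖x‖₊ : ENNReal) < p.radius := lt_of_le_of_lt (by exact_mod_cast hx) hs'
  gcongr
  refine (p.nnnorm_changeOrigin_le n hx').trans ?_
  refine Summable.tsum_le_tsum (fun i => ?_) (p.changeOriginSeries_summable_aux₂ hx' n)
    (p.changeOriginSeries_summable_aux₂ hs' n)
  gcongr

/-- Uniform bounds for the Taylor coefficients of the lift on the unit cube. -/
theorem HasAnalyticRadius.exists_uniform_bound {f : UnitAddTorus (Fin d) → ℂ} {r : ℝ} (hr : 0 < r)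
    (hf : HasAnalyticRadius f r) :
    ∃ M : ℝ, ∀ x ∈ Icc (0 : Fin d → ℝ) 1, ∃ q : FormalMultilinearSeries ℝ (Fin d → ℝ) ℂ,
      HasFPowerSeriesOnBall (fun y => f (toTorus y)) q x (ENNReal.ofReal (r / 2)) ∧
        ∀ n, ‖q n‖ * (r / 4) ^ n ≤ M := by
  -- One `r/4` is spent on moving the centre, another on weighting the coefficients; their sum `r/2`
  -- stays below the radius.
  set s : NNReal := ⟨r / 4, by positivity⟩ with hs
  have hsr : (s : ℝ) = r / 4 := rfl
  have h0 : ∀ x : Fin d → ℝ, ∃ M : ℝ, ∀ y ∈ Metric.ball x (r / 4),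
      ∃ q : FormalMultilinearSeries ℝ (Fin d → ℝ) ℂ,
        HasFPowerSeriesOnBall (fun y => f (toTorus y)) q y (ENNReal.ofReal (r / 2)) ∧
          ∀ n, ‖q n‖ * (r / 4) ^ n ≤ M := by
    intro x
    obtain ⟨p, hp⟩ := hf x
    have hlt : (s : ENNReal) + s < p.radius := by
      refine lt_of_lt_of_le ?_ hp.r_le
      rw [← ENNReal.ofReal_coe_nnreal, hsr, ← ENNReal.ofReal_add (by positivity) (by positivity),
        ENNReal.ofReal_lt_ofReal_iff hr]
      linarith
    obtain ⟨M, hM⟩ := exists_norm_changeOrigin_mul_pow_le p hlt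
    refine ⟨M, fun y hy => ?_⟩
    rw [mem_ball_iff_norm] at hy
    have hy' : ‖y - x‖₊ ≤ s := by
      rw [← NNReal.coe_le_coe, coe_nnnorm, hsr]
      exact hy.le
    have h1 := hp.changeOrigin (y := y - x) (by
      rw [← ENNReal.ofReal_coe_nnreal, coe_nnnorm]
      exact (ENNReal.ofReal_lt_ofReal_iff hr).2 (by linarith))
    rw [add_sub_cancel] at h1
    refine ⟨_, h1.mono (by simpa using hr) ?_, fun n => by exact_mod_cast hM (y - x) hy' n⟩
    rw [← ENNReal.ofReal_coe_nnreal, coe_nnnorm, ← ENNReal.ofReal_sub _ (norm_nonneg _)]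
    exact ENNReal.ofReal_le_ofReal (by linarith)
  choose M hM using h0
  obtain ⟨t, -, ht⟩ := (isCompact_Icc (a := (0 : Fin d → ℝ)) (b := 1)).elim_nhds_subcover
    (fun x => Metric.ball x (r / 4)) (fun x _ => Metric.ball_mem_nhds x (by positivity))
  refine ⟨∑ x ∈ t, |M x|, fun y hy => ?_⟩
  obtain ⟨x, hxt, hx⟩ := mem_iUnion₂.1 (ht hy)
  obtain ⟨q, hq, hqM⟩ := hM x y hx
  exact ⟨q, hq, fun n => (hqM n).trans ((le_abs_self _).trans
    (Finset.single_le_sum (f := fun x => |M x|) (fun _ _ => abs_nonneg _) hxt))⟩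

/-- Expansion of an analytic function along the coordinate directions, with uniform bounds. -/
theorem HasAnalyticRadius.exists_expansion {f : UnitAddTorus (Fin d) → ℂ} {r : ℝ} (hr : 0 < r)
    (hf : HasAnalyticRadius f r) :
    ∃ M : ℝ, ∀ j : Fin d, ∃ a : ℕ → UnitAddTorus (Fin d) → ℂ, (∀ n, Measurable (a n)) ∧
      (∀ n θ, ‖a n θ‖ ≤ M * ((r / 4) ^ n)⁻¹) ∧
        ∀ θ, ∀ t : ℝ, |t| < r / 4 →
          HasSum (fun n => (t : ℂ) ^ n * a n θ) (f (θ + toTorus (Pi.single j t))) := by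
  obtain ⟨M, hM⟩ := hf.exists_uniform_bound hr
  refine ⟨M, fun j => ?_⟩
  set F : (Fin d → ℝ) → ℂ := fun y => f (toTorus y) with hF
  let e : Fin d → ℝ := Pi.single j 1
  let ℓ : UnitAddTorus (Fin d) → Fin d → ℝ := fun θ => (UnitAddTorus.measurableEquivPiIoc 0 θ).1
  have hℓ : Measurable ℓ :=
    measurable_subtype_coe.comp (UnitAddTorus.measurableEquivPiIoc 0).measurable
  have hℓθ : ∀ θ, toTorus (ℓ θ) = θ :=
    fun θ => (UnitAddTorus.measurableEquivPiIoc (0 : Fin d → ℝ)).symm_apply_apply θ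
  have hℓI : ∀ θ, ℓ θ ∈ Icc (0 : Fin d → ℝ) 1 := by
    intro θ
    have := (UnitAddTorus.measurableEquivPiIoc 0 θ).2
    exact ⟨fun i => (this i).1.le, fun i => (this i).2.trans_eq (by simp)⟩
  have hsmooth : ContDiff ℝ ⊤ F := by
    rw [← contDiffOn_univ]
    exact hf.analyticOnNhd.contDiffOn uniqueDiffOn_univ
  -- The coefficients are written as derivatives at the measurable lift `ℓ θ`, not through a chosen
  -- series `q`, so that they are measurable in `θ`.
  refine ⟨fun n θ => (n ! : ℂ)⁻¹ * iteratedFDeriv ℝ n F (ℓ θ) fun _ => e, fun n => ?_, ?_⟩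
  · have hc : Continuous fun x => iteratedFDeriv ℝ n F x fun _ => e :=
      (ContinuousMultilinearMap.apply ℝ (fun _ : Fin n => Fin d → ℝ) ℂ
        (fun _ => e)).continuous.comp (hsmooth.continuous_iteratedFDeriv (by exact_mod_cast le_top))
    exact (hc.measurable.comp hℓ).const_mul _
  · have key : ∀ θ, ∃ q : FormalMultilinearSeries ℝ (Fin d → ℝ) ℂ,
        HasFPowerSeriesOnBall F q (ℓ θ) (ENNReal.ofReal (r / 2)) ∧
          (∀ n, ‖q n‖ * (r / 4) ^ n ≤ M) ∧
            ∀ n, (n ! : ℂ)⁻¹ * iteratedFDeriv ℝ n F (ℓ θ) (fun _ => e) = q n fun _ => e := by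
      intro θ
      obtain ⟨q, hq, hqM⟩ := hM (ℓ θ) (hℓI θ)
      refine ⟨q, hq, hqM, fun n => ?_⟩
      rw [← hq.factorial_smul e n, nsmul_eq_mul, inv_mul_cancel_left₀]
      exact_mod_cast n.factorial_ne_zero
    constructor
    · intro n θ
      obtain ⟨q, -, hqM, hqa⟩ := key θ
      simp only [hqa]
      rw [← div_eq_mul_inv, le_div_iff₀ (by positivity)]
      refine le_trans ?_ (hqM n)
      gcongr
      refine ((q n).le_opNorm _).trans_eq ?_
      simp [e, Pi.norm_single]
    · intro θ t ht
      obtain ⟨q, hq, -, hqa⟩ := key θ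
      have he : Pi.single j t = t • e := by simp [e, ← Pi.single_smul]
      have hmem : Pi.single j t ∈ Metric.eball (0 : Fin d → ℝ) (ENNReal.ofReal (r / 2)) := by
        rw [Metric.eball_ofReal, mem_ball_zero_iff, Pi.norm_single, Real.norm_eq_abs]
        linarith
      have hs := hq.hasSum hmem
      have hv : F (ℓ θ + Pi.single j t) = f (θ + toTorus (Pi.single j t)) := by
        rw [hF]
        simp only
        rw [toTorus_add, hℓθ]
      rw [hv] at hs
      simp only [hqa]
      have hfun : (fun n => (t : ℂ) ^ n * q n fun _ => e) = fun n => q n fun _ => Pi.single j t := by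
        funext n
        rw [he, (q n).map_smul_univ]
        simp
      rw [hfun]
      exact hs

/-! ### Exponential decay of Fourier coefficients -/

theorem mFourier_apply_add (k : Fin d → ℤ) (x y : UnitAddTorus (Fin d)) :
    UnitAddTorus.mFourier k (x + y) = UnitAddTorus.mFourier k x * UnitAddTorus.mFourier k y := by
  simp only [UnitAddTorus.mFourier, ContinuousMap.coe_mk, Pi.add_apply, ← Finset.prod_mul_distrib]
  refine Finset.prod_congr rfl fun i _ => ?_
  simp [fourier_apply, smul_add, AddCircle.toCircle_add]

theorem mFourier_toTorus_single (k : Fin d → ℤ) (j : Fin d) (t : ℝ) :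
    UnitAddTorus.mFourier k (toTorus (Pi.single j t)) =
      Complex.exp (2 * Real.pi * Complex.I * k j * t) := by
  simp only [UnitAddTorus.mFourier, ContinuousMap.coe_mk]
  rw [Finset.prod_eq_single j]
  · simp [toTorus]
  · intro i _ hi
    simp [toTorus, Pi.single_eq_of_ne hi]
  · simp

theorem norm_mFourier_apply (k : Fin d → ℤ) (x : UnitAddTorus (Fin d)) :
    ‖UnitAddTorus.mFourier k x‖ = 1 := by
  simp only [UnitAddTorus.mFourier, ContinuousMap.coe_mk, fourier_apply, norm_prod]
  exact Finset.prod_eq_one fun i _ => Circle.norm_coe _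

theorem integral_mFourier_mul_translate (f : UnitAddTorus (Fin d) → ℂ) (k : Fin d → ℤ)
    (τ : UnitAddTorus (Fin d)) :
    ∫ θ, UnitAddTorus.mFourier (-k) θ * f (θ + τ) =
      UnitAddTorus.mFourier k τ * UnitAddTorus.mFourierCoeff f k := by
  rw [mFourierCoeff_eq, ← integral_const_mul, ← integral_add_right_eq_self
    (fun θ => UnitAddTorus.mFourier k τ * (UnitAddTorus.mFourier (-k) θ * f θ)) τ]
  refine integral_congr_ae (ae_of_all _ fun θ => ?_)
  have h1 : UnitAddTorus.mFourier k τ * UnitAddTorus.mFourier (-k) τ = 1 := by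
    rw [← UnitAddTorus.mFourier_add, add_neg_cancel, UnitAddTorus.mFourier_zero]
    rfl
  simp only
  rw [mFourier_apply_add]
  linear_combination (-(UnitAddTorus.mFourier (-k) θ * f (θ + τ))) * h1

/-- Two power series in a real variable that agree near zero have the same coefficients. -/
theorem coeff_eq_of_hasSum {a b : ℕ → ℂ} {g : ℝ → ℂ}
    (ha : ∀ᶠ t : ℝ in 𝓝 0, HasSum (fun n => (t : ℂ) ^ n * a n) (g t))
    (hb : ∀ᶠ t : ℝ in 𝓝 0, HasSum (fun n => (t : ℂ) ^ n * b n) (g t)) : a = b := by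
  have key : ∀ c : ℕ → ℂ, (∀ᶠ t : ℝ in 𝓝 0, HasSum (fun n => (t : ℂ) ^ n * c n) (g t)) →
      HasFPowerSeriesAt g
        (fun n => ContinuousMultilinearMap.mkPiRing ℝ (Fin n) (c n)) (0 : ℝ) := by
    intro c hc
    refine hasFPowerSeriesAt_iff.2 ?_
    filter_upwards [hc] with t ht
    simpa [FormalMultilinearSeries.coeff] using ht
  have h := (key a ha).eq_formalMultilinearSeries (key b hb)
  funext n
  have := congrArg (fun p : FormalMultilinearSeries ℝ ℝ ℂ => p.coeff n) h
  simpa [FormalMultilinearSeries.coeff] using this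

/-- This replaces shifting a contour into a complex strip. Integrating the expansion of `f (θ + t
e_j)` against the character expands `e^{2πi k_j t} c` in powers of `t`, with coefficients bounded by
`M (r/4)^(-n)`. Comparing coefficients bounds `(2π|k_j|)^n / n! · ‖c‖`; weighting by `(r/8)^n` and
summing rebuilds the exponential. -/
theorem HasAnalyticRadius.exists_norm_mFourierCoeff_le_apply {f : UnitAddTorus (Fin d) → ℂ} {r : ℝ}
    (hr : 0 < r) (hf : HasAnalyticRadius f r) :
    ∃ M : ℝ, 0 ≤ M ∧ ∀ (k : Fin d → ℤ) (j : Fin d),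
      ‖UnitAddTorus.mFourierCoeff f k‖ ≤ M * Real.exp (-(Real.pi * r / 4 * |(k j : ℝ)|)) := by
  obtain ⟨M, hM⟩ := hf.exists_expansion hr
  refine ⟨2 * |M|, by positivity, fun k j => ?_⟩
  obtain ⟨a, ham, hab, has⟩ := hM j
  set c := UnitAddTorus.mFourierCoeff f k with hc
  have hFm : Measurable fun θ => UnitAddTorus.mFourier (-k) θ :=
    (UnitAddTorus.mFourier (-k)).continuous.measurable
  let b : ℕ → ℂ := fun n => ∫ θ, UnitAddTorus.mFourier (-k) θ * a n θ
  have hb : ∀ n, ‖b n‖ ≤ M * ((r / 4) ^ n)⁻¹ := by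
    intro n
    refine (norm_integral_le_of_norm_le_const (C := M * ((r / 4) ^ n)⁻¹)
      (ae_of_all _ fun θ => ?_)).trans_eq ?_
    · rw [norm_mul, norm_mFourier_apply, one_mul]
      exact hab n θ
    · simp
  have hs1 : ∀ᶠ t : ℝ in 𝓝 0, HasSum (fun n => (t : ℂ) ^ n * b n)
      (Complex.exp (2 * Real.pi * Complex.I * k j * t) * c) := by
    filter_upwards [Metric.ball_mem_nhds (0 : ℝ) (ε := r / 4) (by positivity)] with t ht
    rw [mem_ball_zero_iff, Real.norm_eq_abs] at ht
    rw [← mFourier_toTorus_single, hc, ← integral_mFourier_mul_translate]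
    have := hasSum_integral_of_dominated_convergence (μ := (volume : Measure (UnitAddTorus (Fin d))))
      (F := fun n θ => (t : ℂ) ^ n * (UnitAddTorus.mFourier (-k) θ * a n θ))
      (f := fun θ => UnitAddTorus.mFourier (-k) θ * f (θ + toTorus (Pi.single j t)))
      (fun n _ => M * (|t| / (r / 4)) ^ n)
      (fun n => ((hFm.mul (ham n)).const_mul _).aestronglyMeasurable)
      (fun n => ae_of_all _ fun θ => ?_) (ae_of_all _ fun _ => ?_) (integrable_const _)
      (ae_of_all _ fun θ => ?_)
    · simpa only [integral_const_mul] using this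
    · rw [norm_mul, norm_mul, norm_mFourier_apply, one_mul, norm_pow, Complex.norm_real,
        Real.norm_eq_abs, div_pow]
      calc |t| ^ n * ‖a n θ‖ ≤ |t| ^ n * (M * ((r / 4) ^ n)⁻¹) := by gcongr; exact hab n θ
        _ = _ := by ring
    · exact (summable_geometric_of_lt_one (by positivity)
        ((div_lt_one (by positivity)).2 ht)).mul_left _
    · simpa only [mul_left_comm] using (has θ t ht).mul_left (UnitAddTorus.mFourier (-k) θ)
  have hs2 : ∀ᶠ t : ℝ in 𝓝 0,
      HasSum (fun n => (t : ℂ) ^ n * ((2 * Real.pi * Complex.I * k j) ^ n / n ! * c))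
        (Complex.exp (2 * Real.pi * Complex.I * k j * t) * c) := by
    refine Eventually.of_forall fun t => ?_
    have := (NormedSpace.expSeries_div_hasSum_exp
      (2 * Real.pi * Complex.I * k j * (t : ℂ))).mul_right c
    rw [← Complex.exp_eq_exp_ℂ] at this
    refine (funext fun n => ?_ : (fun n => (t : ℂ) ^ n *
      ((2 * Real.pi * Complex.I * k j) ^ n / n ! * c)) = _) ▸ this
    rw [mul_pow _ (t : ℂ)]
    ring
  have hcoef := coeff_eq_of_hasSum hs2 hs1
  have hbound : ∀ n : ℕ, (2 * Real.pi * |(k j : ℝ)| * (r / 8)) ^ n / n ! * ‖c‖ ≤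
      |M| * (1 / 2) ^ n := by
    intro n
    have h1 := hb n
    rw [← hcoef] at h1
    simp only [norm_mul, norm_div, norm_pow, Complex.norm_real, Complex.norm_I,
      Complex.norm_natCast, Complex.norm_intCast, Real.norm_eq_abs, abs_of_pos Real.pi_pos,
      Complex.norm_two, mul_one] at h1
    calc (2 * Real.pi * |(k j : ℝ)| * (r / 8)) ^ n / n ! * ‖c‖
        = (2 * Real.pi * |(k j : ℝ)|) ^ n / n ! * ‖c‖ * (r / 8) ^ n := by rw [mul_pow]; ring
      _ ≤ M * ((r / 4) ^ n)⁻¹ * (r / 8) ^ n := by gcongr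
      _ = M * (1 / 2) ^ n := by
        rw [show r / 8 = r / 4 * (1 / 2) by ring, mul_pow]
        field_simp
      _ ≤ |M| * (1 / 2) ^ n := by gcongr; exact le_abs_self M
  have hE := (NormedSpace.expSeries_div_hasSum_exp
    (2 * Real.pi * |(k j : ℝ)| * (r / 8))).mul_right ‖c‖
  rw [← Real.exp_eq_exp_ℝ] at hE
  have hG := (hasSum_geometric_two).mul_left |M|
  have := hasSum_le hbound hE hG
  rw [show Real.pi * r / 4 * |(k j : ℝ)| = 2 * Real.pi * |(k j : ℝ)| * (r / 8) by ring,
    Real.exp_neg, ← div_eq_mul_inv, le_div_iff₀ (Real.exp_pos _)]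
  linarith

/-- Exponential decay of the Fourier coefficients of an analytic function. -/
theorem HasAnalyticRadius.exists_norm_mFourierCoeff_le {f : UnitAddTorus (Fin d) → ℂ} {r : ℝ}
    (hd : 1 ≤ d) (hr : 0 < r) (hf : HasAnalyticRadius f r) :
    ∃ M : ℝ, 0 ≤ M ∧ ∀ k : Fin d → ℤ, ‖UnitAddTorus.mFourierCoeff f k‖ ≤
      M * Real.exp (-(Real.pi * r / (4 * d) * ∑ j, |(k j : ℝ)|)) := by
  obtain ⟨M, hM0, hM⟩ := hf.exists_norm_mFourierCoeff_le_apply hr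
  refine ⟨M, hM0, fun k => ?_⟩
  have : Nonempty (Fin d) := ⟨⟨0, hd⟩⟩
  obtain ⟨j, hj⟩ := Finite.exists_max fun j => |(k j : ℝ)|
  have hd' : (0 : ℝ) < d := by exact_mod_cast hd
  have hsum : ∑ i, |(k i : ℝ)| ≤ d * |(k j : ℝ)| := by
    refine (Finset.sum_le_card_nsmul _ _ _ fun i _ => hj i).trans_eq ?_
    simp
  refine (hM k j).trans (mul_le_mul_of_nonneg_left (Real.exp_le_exp.2 (neg_le_neg ?_)) hM0)
  calc Real.pi * r / (4 * d) * ∑ i, |(k i : ℝ)| ≤ Real.pi * r / (4 * d) * (d * |(k j : ℝ)|) := by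
        have := Real.pi_pos
        gcongr
    _ = Real.pi * r / 4 * |(k j : ℝ)| := by
      field_simp

/-! ### From small divisors to error bounds -/

theorem mFourier_eq_toCircle (k : Fin d → ℤ) (ρ : UnitAddTorus (Fin d)) :
    UnitAddTorus.mFourier k ρ = (AddCircle.toCircle (∑ j, k j • ρ j) : ℂ) := by
  simp only [UnitAddTorus.mFourier, ContinuousMap.coe_mk, fourier_apply]
  generalize (Finset.univ : Finset (Fin d)) = s
  induction s using Finset.induction_on with
  | empty => simp
  | insert i s hi ih =>
    rw [Finset.prod_insert hi, Finset.sum_insert hi, AddCircle.toCircle_add, Circle.coe_mul, ih]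

theorem mFourier_rotation_iterate (k : Fin d → ℤ) (ρ θ : UnitAddTorus (Fin d)) (n : ℕ) :
    UnitAddTorus.mFourier k ((rotation ρ)^[n] θ) =
      UnitAddTorus.mFourier k θ * (AddCircle.toCircle (∑ j, k j • ρ j) : ℂ) ^ n := by
  rw [← mFourier_eq_toCircle]
  induction n with
  | zero => simp
  | succ n ih =>
    rw [Function.iterate_succ_apply', rotation, mFourier_apply_add, ih, pow_succ, mul_assoc]

/-- The error is bounded by the sum of the contributions of the nonzero frequencies. -/
theorem birkhoffError_le_of_hasSum {f : UnitAddTorus (Fin d) → ℂ} {c : (Fin d → ℤ) → ℂ}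
    (hf : ∀ θ, HasSum (fun k => c k * UnitAddTorus.mFourier k θ) (f θ)) (hint : ∫ θ, f θ = c 0)
    {ρ : UnitAddTorus (Fin d)} {N : ℕ} (hN : 2 ≤ N) {g : (Fin d → ℤ) → ℝ} {B : ℝ}
    (hg0 : ∀ k, 0 ≤ g k) (hg : HasSum g B)
    (hcg : ∀ k, k ≠ 0 → ‖c k‖ * ‖weightedExpSum N (∑ j, k j • ρ j)‖ ≤ g k)
    (θ : UnitAddTorus (Fin d)) : birkhoffError f ρ N θ ≤ B := by
  have hsum : HasSum (fun k => c k * UnitAddTorus.mFourier k θ *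
      weightedExpSum N (∑ j, k j • ρ j)) (weightedAverage f ρ N θ) := by
    have h := (hasSum_sum (s := Finset.range N) fun n _ =>
      (hf ((rotation ρ)^[n] θ)).mul_left (weight ((n : ℝ) / N) : ℂ)).mul_left (weightSum N : ℂ)⁻¹
    refine (funext fun k => ?_ : (fun k => c k * UnitAddTorus.mFourier k θ *
      weightedExpSum N (∑ j, k j • ρ j)) = _) ▸ h
    simp only [weightedExpSum, mFourier_rotation_iterate, Finset.mul_sum]
    refine Finset.sum_congr rfl fun n _ => ?_
    ring
  have h0 : c 0 * UnitAddTorus.mFourier 0 θ * weightedExpSum N (∑ j, (0 : Fin d → ℤ) j • ρ j) =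
      c 0 := by
    simp [UnitAddTorus.mFourier_zero, weightedExpSum_zero hN]
  have h := hasSum_ite_sub_hasSum hsum 0
  rw [h0] at h
  rw [birkhoffError, hint]
  refine h.norm_le_of_bounded hg fun k => ?_
  split_ifs with hk
  · simpa using hg0 k
  · rw [norm_mul, norm_mul, norm_mFourier_apply, mul_one]
    exact hcg k hk

theorem summable_exp_neg_mul_sum_abs (d : ℕ) {l : ℝ} (hl : 0 < l) :
    Summable fun k : Fin d → ℤ => Real.exp (-(l * ∑ j, |(k j : ℝ)|)) := by
  have h1 : Summable fun n : ℤ => Real.exp (-(l * |(n : ℝ)|)) := by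
    have hn : Summable fun n : ℕ => Real.exp (-(l * n)) := by
      have := Real.summable_exp_nat_mul_iff.2 (neg_neg_of_pos hl)
      refine this.congr fun n => ?_
      congr 1
      ring
    refine Summable.of_nat_of_neg ?_ ?_ <;> simpa using hn
  have e : ∀ k : Fin d → ℤ, Real.exp (-(l * ∑ j, |(k j : ℝ)|)) =
      ∏ j, Real.exp (-(l * |(k j : ℝ)|)) := by
    intro k
    rw [← Real.exp_sum, Finset.sum_neg_distrib, Finset.mul_sum]
  simp_rw [e]
  refine summable_of_sum_le (c := (∑' n : ℤ, Real.exp (-(l * |(n : ℝ)|))) ^ d)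
    (fun k => Finset.prod_nonneg fun _ _ => (Real.exp_pos _).le) fun u => ?_
  have hu : u ⊆ Fintype.piFinset fun j => u.image fun k => k j := by
    intro k hk
    rw [Fintype.mem_piFinset]
    exact fun j => Finset.mem_image_of_mem _ hk
  refine (Finset.sum_le_sum_of_subset_of_nonneg hu fun k _ _ =>
    Finset.prod_nonneg fun _ _ => (Real.exp_pos _).le).trans ?_
  rw [← Finset.prod_univ_sum (fun j => u.image fun k => k j)
    fun (_ : Fin d) (n : ℤ) => Real.exp (-(l * |(n : ℝ)|))]
  refine (Finset.prod_le_prod (fun _ _ => Finset.sum_nonneg fun _ _ => (Real.exp_pos _).le)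
    fun j _ => h1.sum_le_tsum _ fun _ _ => (Real.exp_pos _).le).trans_eq ?_
  simp

theorem norm_weightedExpSum_le_of_le {N : ℕ} (hN : 2 ≤ N) {x : UnitAddCircle} {D : ℝ}
    (hD : D ≤ ‖x‖) :
    ‖weightedExpSum N x‖ ≤ 6 * Real.exp 6 * N * Real.exp (-(√(N * D) / 4)) := by
  refine (norm_weightedExpSum_le hN x).trans ?_
  gcongr

/-- Error bound for an analytic observable, in terms of a lower bound `D` for the small divisors
with frequency at most `X`. -/
theorem HasAnalyticRadius.exists_birkhoffError_le {f : UnitAddTorus (Fin d) → ℂ} {r : ℝ}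
    (hd : 1 ≤ d) (hr : 0 < r) (hf : HasAnalyticRadius f r) :
    ∃ K : ℝ, 0 ≤ K ∧ ∀ (ρ : UnitAddTorus (Fin d)) (N : ℕ) (X D : ℝ), 2 ≤ N →
      (∀ k : Fin d → ℤ, k ≠ 0 → ∑ j, |(k j : ℝ)| ≤ X → D ≤ ‖∑ j, k j • ρ j‖) →
      ∀ θ, birkhoffError f ρ N θ ≤ K * N *
        (Real.exp (-(√(N * D) / 4)) + Real.exp (-(Real.pi * r / (8 * d) * X))) := by
  obtain ⟨M, hM0, hM⟩ := hf.exists_norm_mFourierCoeff_le hd hr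
  have hd' : (0 : ℝ) < d := by exact_mod_cast hd
  -- Half the decay rate of the coefficients: one `l` gives the tail factor `exp(-l X)`, the other
  -- keeps the sum over `k` convergent.
  set l := Real.pi * r / (8 * d) with hl
  have hl0 : 0 < l := by
    have := Real.pi_pos
    positivity
  have hl2 : Real.pi * r / (4 * d) = 2 * l := by
    rw [hl]
    field_simp
    norm_num
  rw [hl2] at hM
  have hE := summable_exp_neg_mul_sum_abs d hl0
  set E := ∑' k : Fin d → ℤ, Real.exp (-(l * ∑ j, |(k j : ℝ)|)) with hEdef
  have hE0 : 0 ≤ E := tsum_nonneg fun _ => (Real.exp_pos _).le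
  refine ⟨M * (6 * Real.exp 6) * E, by positivity, fun ρ N X D hN hD θ => ?_⟩
  have hcoef : Summable (UnitAddTorus.mFourierCoeff f) := by
    refine Summable.of_norm_bounded ((summable_exp_neg_mul_sum_abs d
      (by positivity : 0 < 2 * l)).mul_left M) hM
  have hFourier : ∀ θ, HasSum
      (fun k => UnitAddTorus.mFourierCoeff f k * UnitAddTorus.mFourier k θ) (f θ) := fun θ =>
    UnitAddTorus.hasSum_mFourier_series_apply_of_summable (f := ⟨f, hf.continuous⟩) hcoef θ
  have hint : ∫ θ, f θ = UnitAddTorus.mFourierCoeff f 0 := by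
    rw [mFourierCoeff_eq]
    simp [UnitAddTorus.mFourier_zero]
  set A := Real.exp (-(√(N * D) / 4)) + Real.exp (-(l * X)) with hA
  have hg := hE.hasSum.mul_left (M * (6 * Real.exp 6) * N * A)
  refine (birkhoffError_le_of_hasSum hFourier hint hN (fun k => ?_) hg (fun k hk => ?_)
    θ).trans_eq ?_
  · positivity
  · set s := ∑ j, |(k j : ℝ)| with hs
    have hs0 : 0 ≤ s := Finset.sum_nonneg fun _ _ => abs_nonneg _
    have key : Real.exp (-(2 * l * s)) * ‖weightedExpSum N (∑ j, k j • ρ j)‖ ≤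
        6 * Real.exp 6 * N * (A * Real.exp (-(l * s))) := by
      have e2 : Real.exp (-(2 * l * s)) = Real.exp (-(l * s)) * Real.exp (-(l * s)) := by
        rw [← Real.exp_add]
        ring_nf
      rcases le_or_gt s X with h | h
      · calc Real.exp (-(2 * l * s)) * ‖weightedExpSum N (∑ j, k j • ρ j)‖
            ≤ Real.exp (-(l * s)) * (6 * Real.exp 6 * N * Real.exp (-(√(N * D) / 4))) := by
              gcongr
              · nlinarith
              · exact norm_weightedExpSum_le_of_le hN (hD k hk h)
          _ = 6 * Real.exp 6 * N * (Real.exp (-(√(N * D) / 4)) * Real.exp (-(l * s))) := by ring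
          _ ≤ _ := by
            gcongr
            exact le_add_of_nonneg_right (Real.exp_pos _).le
      · calc Real.exp (-(2 * l * s)) * ‖weightedExpSum N (∑ j, k j • ρ j)‖
            ≤ (Real.exp (-(l * X)) * Real.exp (-(l * s))) * (6 * Real.exp 6 * N * 1) := by
              rw [e2]
              gcongr
              refine (norm_weightedExpSum_le_of_le hN (norm_nonneg _)).trans ?_
              simp
          _ = 6 * Real.exp 6 * N * (Real.exp (-(l * X)) * Real.exp (-(l * s))) := by ring
          _ ≤ _ := by
            gcongr
            exact le_add_of_nonneg_left (Real.exp_pos _).le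
    calc ‖UnitAddTorus.mFourierCoeff f k‖ * ‖weightedExpSum N (∑ j, k j • ρ j)‖
        ≤ M * Real.exp (-(2 * l * s)) * ‖weightedExpSum N (∑ j, k j • ρ j)‖ := by
          gcongr
          exact hM k
      _ = M * (Real.exp (-(2 * l * s)) * ‖weightedExpSum N (∑ j, k j • ρ j)‖) := by ring
      _ ≤ M * (6 * Real.exp 6 * N * (A * Real.exp (-(l * s)))) := by gcongr
      _ = M * (6 * Real.exp 6) * N * A * Real.exp (-(l * s)) := by ring
  · ring

/-- Error bound for a trigonometric polynomial in terms of its smallest divisor. -/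
theorem birkhoffError_trigPoly_le (S : Finset (Fin d → ℤ)) (a : (Fin d → ℤ) → ℂ)
    {ρ : UnitAddTorus (Fin d)} {D : ℝ}
    (hD : ∀ k ∈ S, k ≠ 0 → D ≤ ‖∑ j, k j • ρ j‖) {N : ℕ} (hN : 2 ≤ N)
    (θ : UnitAddTorus (Fin d)) : birkhoffError (trigPoly S a) ρ N θ ≤
      (∑ k ∈ S, ‖a k‖) * (6 * Real.exp 6 * N * Real.exp (-(√(N * D) / 4))) := by
  classical
  let c : (Fin d → ℤ) → ℂ := fun k => if k ∈ S then a k else 0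
  have hc : ∀ θ, HasSum (fun k => c k * UnitAddTorus.mFourier k θ) (trigPoly S a θ) := by
    intro θ
    have h : HasSum (fun k => c k * UnitAddTorus.mFourier k θ)
        (∑ k ∈ S, c k * UnitAddTorus.mFourier k θ) :=
      hasSum_sum_of_ne_finset_zero fun k hk => by simp [c, hk]
    have e : ∑ k ∈ S, c k * UnitAddTorus.mFourier k θ = trigPoly S a θ :=
      Finset.sum_congr rfl fun k hk => by simp [c, hk]
    rwa [e] at h
  have hmF : ∀ k : Fin d → ℤ,
      ∫ θ, UnitAddTorus.mFourier k θ = if k = 0 then (1 : ℂ) else 0 := by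
    intro k
    split_ifs with hk
    · simp [hk, UnitAddTorus.mFourier_zero]
    · obtain ⟨j, hj⟩ := Function.ne_iff.1 hk
      -- Translation by half a period in direction `j` flips the sign of the character, so its
      -- integral vanishes.
      have h := integral_add_right_eq_self (μ := (volume : Measure (UnitAddTorus (Fin d))))
        (fun θ => UnitAddTorus.mFourier k θ) (toTorus (Pi.single j (1 / (2 * (k j : ℝ)))))
      have hj' : (k j : ℂ) ≠ 0 := by exact_mod_cast hj
      have e : UnitAddTorus.mFourier k (toTorus (Pi.single j (1 / (2 * (k j : ℝ))))) = -1 := by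
        rw [mFourier_toTorus_single, ← Complex.exp_pi_mul_I]
        congr 1
        push_cast
        field_simp
      simp only [mFourier_apply_add, e, mul_neg, mul_one, integral_neg] at h
      exact self_eq_neg.1 h.symm
  have hint : ∫ θ, trigPoly S a θ = c 0 := by
    simp only [trigPoly]
    rw [integral_finsetSum]
    · simp only [integral_const_mul, hmF, c, mul_ite, mul_one, mul_zero, Finset.sum_ite_eq']
    · intro k _
      exact ((UnitAddTorus.mFourier k).continuous.integrable_of_hasCompactSupport
        (HasCompactSupport.of_compactSpace _)).const_mul _
  set B := 6 * Real.exp 6 * N * Real.exp (-(√(N * D) / 4)) with hB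
  have hg : HasSum (fun k => ‖c k‖ * B) ((∑ k ∈ S, ‖a k‖) * B) := by
    refine HasSum.mul_right B ?_
    have h : HasSum (fun k => ‖c k‖) (∑ k ∈ S, ‖c k‖) :=
      hasSum_sum_of_ne_finset_zero fun k hk => by simp [c, hk]
    have e : ∑ k ∈ S, ‖c k‖ = ∑ k ∈ S, ‖a k‖ :=
      Finset.sum_congr rfl fun k hk => by simp [c, hk]
    rwa [e] at h
  refine birkhoffError_le_of_hasSum hc hint hN (fun k => by positivity) hg (fun k hk => ?_) θ
  by_cases hkS : k ∈ S
  · gcongr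
    exact norm_weightedExpSum_le_of_le hN (hD k hkS hk)
  · simp [c, hkS]

/-! ### Diophantine properties of almost every rotation -/

/-- A nontrivial character `ρ ↦ k · ρ` of the torus preserves Haar measure. -/
theorem measurePreserving_sum_zsmul {k : Fin d → ℤ} (hk : k ≠ 0) :
    MeasurePreserving (fun ρ : UnitAddTorus (Fin d) => ∑ j, k j • ρ j) := by
  let χ : UnitAddTorus (Fin d) →+ UnitAddCircle :=
    { toFun := fun ρ => ∑ j, k j • ρ j
      map_zero' := by simp
      map_add' := fun x y => by simp [smul_add, Finset.sum_add_distrib] }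
  have hcont : Continuous χ := by
    change Continuous fun ρ : UnitAddTorus (Fin d) => ∑ j, k j • ρ j
    fun_prop
  have hsurj : Function.Surjective χ := by
    intro x
    obtain ⟨y, rfl⟩ := QuotientAddGroup.mk_surjective x
    obtain ⟨j, hj⟩ := Function.ne_iff.1 hk
    have hj' : (k j : ℝ) ≠ 0 := by exact_mod_cast hj
    refine ⟨Pi.single j ((y / k j : ℝ) : UnitAddCircle), ?_⟩
    change ∑ i, k i • (Pi.single j ((y / k j : ℝ) : UnitAddCircle) : UnitAddTorus (Fin d)) i =
      (y : UnitAddCircle)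
    rw [Finset.sum_eq_single j]
    · rw [Pi.single_eq_same, ← AddCircle.coe_zsmul, zsmul_eq_mul, mul_div_cancel₀ _ hj']
    · intro i _ hi
      simp [Pi.single_eq_of_ne hi]
    · simp
  exact AddMonoidHom.measurePreserving (f := χ) hcont hsurj (by simp)

theorem volume_norm_sum_zsmul_le {k : Fin d → ℤ} (hk : k ≠ 0) (ε : ℝ) :
    volume {ρ : UnitAddTorus (Fin d) | ‖∑ j, k j • ρ j‖ ≤ ε} ≤ ENNReal.ofReal (2 * ε) := by
  have h := (measurePreserving_sum_zsmul hk).measure_preimage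
    (Metric.isClosed_closedBall (x := (0 : UnitAddCircle)) (ε := ε)).measurableSet.nullMeasurableSet
  have e : {ρ : UnitAddTorus (Fin d) | ‖∑ j, k j • ρ j‖ ≤ ε} =
      (fun ρ : UnitAddTorus (Fin d) => ∑ j, k j • ρ j) ⁻¹'
        Metric.closedBall (0 : UnitAddCircle) ε := by
    ext ρ
    simp
  rw [e, h, AddCircle.volume_closedBall]
  exact ENNReal.ofReal_le_ofReal (min_le_right _ _)

theorem ae_sum_zsmul_ne_zero (d : ℕ) :
    ∀ᵐ ρ : UnitAddTorus (Fin d), ∀ k : Fin d → ℤ, k ≠ 0 → 0 < ‖∑ j, k j • ρ j‖ := by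
  rw [ae_all_iff]
  intro k
  by_cases hk : k = 0
  · simp [hk]
  · have h := volume_norm_sum_zsmul_le hk 0
    rw [mul_zero, ENNReal.ofReal_zero, nonpos_iff_eq_zero] at h
    filter_upwards [measure_eq_zero_iff_ae_notMem.1 h] with ρ hρ _
    exact not_le.1 hρ

theorem exists_pos_forall_le {ι : Type*} (s : Finset ι) (f : ι → ℝ) (hf : ∀ i ∈ s, 0 < f i) :
    ∃ C : ℝ, 0 < C ∧ ∀ i ∈ s, C ≤ f i := by
  rcases s.eq_empty_or_nonempty with rfl | hs
  · exact ⟨1, one_pos, by simp⟩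
  · obtain ⟨i, hi, h⟩ := s.exists_min_image f hs
    exact ⟨f i, hf i hi, h⟩

/-- The integer points of the cube with side `2 ^ (j + 2)`. -/
def dyadicCube (d j : ℕ) : Finset (Fin d → ℤ) :=
  Fintype.piFinset fun _ => Finset.Icc (-2 ^ (j + 1)) (2 ^ (j + 1))

theorem card_dyadicCube_le (d j : ℕ) : ((dyadicCube d j).card : ℝ) ≤ 8 ^ d * (2 ^ j) ^ d := by
  rw [dyadicCube, Fintype.card_piFinset_const, Int.card_Icc, ← mul_pow]
  have h : ((2 ^ (j + 1) + 1 - -2 ^ (j + 1) : ℤ)).toNat ≤ 8 * 2 ^ j := by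
    rw [Int.toNat_le]
    have : (1 : ℤ) ≤ 2 ^ j := one_le_pow₀ (by norm_num)
    push_cast
    rw [pow_succ]
    linarith
  exact_mod_cast Nat.pow_le_pow_left h d

theorem mem_dyadicCube {j : ℕ} {k : Fin d → ℤ} (hk : ∑ i, |(k i : ℝ)| ≤ 2 ^ (j + 1)) :
    k ∈ dyadicCube d j := by
  rw [dyadicCube, Fintype.mem_piFinset]
  intro i
  have h := (Finset.single_le_sum (f := fun i => |(k i : ℝ)|) (fun _ _ => abs_nonneg _)
    (Finset.mem_univ i)).trans hk
  have h' : |k i| ≤ 2 ^ (j + 1) := by exact_mod_cast h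
  exact Finset.mem_Icc.2 (abs_le.1 h')

theorem one_le_sum_abs {k : Fin d → ℤ} (hk : k ≠ 0) : 1 ≤ ∑ i, |(k i : ℝ)| := by
  obtain ⟨i, hi⟩ := Function.ne_iff.1 hk
  refine le_trans ?_ (Finset.single_le_sum (f := fun i => |(k i : ℝ)|) (fun _ _ => abs_nonneg _)
    (Finset.mem_univ i))
  exact_mod_cast Int.one_le_abs hi

/-- Borel–Cantelli: at most `8^d 2^{jd}` frequencies, each with a bad set of measure at most `2 ·
2^{-jd} (j+1)^{-ζ}`, give a total that is summable in `j` because `ζ > 1`. -/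
theorem ae_eventually_dyadic (d : ℕ) {ζ : ℝ} (hζ : 1 < ζ) :
    ∀ᵐ ρ : UnitAddTorus (Fin d), ∀ᶠ j : ℕ in atTop, ∀ k ∈ dyadicCube d j, k ≠ 0 →
      ((2 ^ j) ^ d)⁻¹ * ((j + 1 : ℕ) : ℝ) ^ (-ζ) < ‖∑ i, k i • ρ i‖ := by
  let s : ℕ → Set (UnitAddTorus (Fin d)) := fun j => ⋃ k ∈ (dyadicCube d j).erase 0,
    {ρ | ‖∑ i, k i • ρ i‖ ≤ ((2 ^ j) ^ d)⁻¹ * ((j + 1 : ℕ) : ℝ) ^ (-ζ)}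
  have hs : ∀ j, volume (s j) ≤ ENNReal.ofReal (2 * 8 ^ d * ((j + 1 : ℕ) : ℝ) ^ (-ζ)) := by
    intro j
    have hε : (0 : ℝ) ≤ ((j + 1 : ℕ) : ℝ) ^ (-ζ) := by positivity
    refine (measure_biUnion_finset_le _ _).trans ?_
    refine (Finset.sum_le_sum fun k hk =>
      volume_norm_sum_zsmul_le (Finset.ne_of_mem_erase hk) _).trans ?_
    rw [Finset.sum_const, nsmul_eq_mul, ← ENNReal.ofReal_natCast, ← ENNReal.ofReal_mul (by simp)]
    refine ENNReal.ofReal_le_ofReal ?_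
    have hcard : (((dyadicCube d j).erase 0).card : ℝ) ≤ 8 ^ d * (2 ^ j) ^ d :=
      le_trans (by exact_mod_cast Finset.card_erase_le) (card_dyadicCube_le d j)
    refine (mul_le_mul_of_nonneg_right hcard (by positivity)).trans_eq ?_
    field_simp
  have hsum : ∑' j, volume (s j) ≠ ⊤ := by
    refine ne_top_of_le_ne_top ?_ (ENNReal.tsum_le_tsum hs)
    have : Summable fun j : ℕ => 2 * 8 ^ d * ((j + 1 : ℕ) : ℝ) ^ (-ζ) :=
      ((summable_nat_add_iff 1).2 (Real.summable_nat_rpow.2 (by linarith))).mul_left _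
    rw [← ENNReal.ofReal_tsum_of_nonneg (fun j => by positivity) this]
    exact ENNReal.ofReal_ne_top
  filter_upwards [ae_eventually_notMem hsum] with ρ hρ
  filter_upwards [hρ] with j hj k hk hk0
  by_contra! h
  exact hj (mem_iUnion₂.2 ⟨k, Finset.mem_erase.2 ⟨hk0, hk⟩, h⟩)

/-- Almost every rotation satisfies a Diophantine condition with a logarithmic loss. -/
theorem ae_exists_logDiophantine (d : ℕ) {ζ : ℝ} (hζ : 1 < ζ) :
    ∀ᵐ ρ : UnitAddTorus (Fin d), ∃ C : ℝ, 0 < C ∧ ∀ k : Fin d → ℤ, k ≠ 0 →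
      C / ((∑ i, |(k i : ℝ)|) ^ d * (1 + Real.log (∑ i, |(k i : ℝ)|)) ^ ζ) ≤
        ‖∑ i, k i • ρ i‖ := by
  filter_upwards [ae_eventually_dyadic d hζ, ae_sum_zsmul_ne_zero d] with ρ h1 h2
  obtain ⟨J, hJ⟩ := eventually_atTop.1 h1
  obtain ⟨C, hC, hCk⟩ := exists_pos_forall_le ((dyadicCube d J).erase 0)
    (fun k => ‖∑ i, k i • ρ i‖) fun k hk => h2 k (Finset.ne_of_mem_erase hk)
  have h2pos : (0 : ℝ) < 2 ^ (-ζ) := by positivity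
  -- `C` serves the finitely many frequencies below the Borel–Cantelli threshold; `2^(-ζ)` pays for
  -- `j + 1 ≤ 2 (1 + log s)` above it.
  refine ⟨min C (2 ^ (-ζ)), lt_min hC h2pos, fun k hk => ?_⟩
  have hs1 := one_le_sum_abs hk
  set s := ∑ i, |(k i : ℝ)| with hs
  have hlog : 0 ≤ Real.log s := Real.log_nonneg hs1
  have hden : 1 ≤ s ^ d * (1 + Real.log s) ^ ζ :=
    one_le_mul_of_one_le_of_one_le (one_le_pow₀ hs1)
      (Real.one_le_rpow (by linarith) (by linarith))
  rcases le_or_gt s (2 ^ (J + 1)) with h | h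
  · refine (div_le_self (by positivity) hden).trans ((min_le_left _ _).trans ?_)
    exact hCk k (Finset.mem_erase.2 ⟨hk, mem_dyadicCube h⟩)
  · obtain ⟨j, hj1, hj2⟩ := exists_nat_pow_near hs1 (by norm_num : (1 : ℝ) < 2)
    have hJj : J ≤ j := by
      by_contra! hlt
      have : (2 : ℝ) ^ (j + 1) ≤ 2 ^ (J + 1) := pow_le_pow_right₀ (by norm_num) (by omega)
      linarith
    refine le_trans ?_ (hJ j hJj k (mem_dyadicCube hj2.le) hk).le
    have hjlog : ((j + 1 : ℕ) : ℝ) ≤ 2 * (1 + Real.log s) := by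
      have h3 := Real.log_le_log (by positivity) hj1
      rw [Real.log_pow] at h3
      have := Real.log_two_gt_d9
      push_cast
      nlinarith [(Nat.cast_nonneg j : (0 : ℝ) ≤ j)]
    have hs0 : 0 < s := by linarith
    have hlog' : 0 ≤ 1 + Real.log s := by linarith
    calc min C (2 ^ (-ζ)) / (s ^ d * (1 + Real.log s) ^ ζ)
        ≤ 2 ^ (-ζ) / (s ^ d * (1 + Real.log s) ^ ζ) := by
          gcongr
          exact min_le_right _ _
      _ = (s ^ d)⁻¹ * (2 * (1 + Real.log s)) ^ (-ζ) := by
          rw [Real.mul_rpow (by norm_num) hlog', Real.rpow_neg hlog']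
          field_simp
      _ ≤ ((2 ^ j) ^ d)⁻¹ * ((j + 1 : ℕ) : ℝ) ^ (-ζ) := by
          refine mul_le_mul ?_ (Real.rpow_le_rpow_of_nonpos (by positivity) hjlog
            (neg_nonpos.2 (by linarith))) (by positivity) (by positivity)
          gcongr

/-! ### Choice of the cutoff and resulting rates -/

/-- Absorbs the factor `N`, a power of `X`, into part of the exponential. -/
theorem pow_mul_exp_neg_mul_le {X γ : ℝ} (hX : 0 ≤ X) (hγ : 0 < γ) (p : ℕ) :
    X ^ p * Real.exp (-(γ * X)) ≤ p ! / γ ^ p := by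
  have h := Real.pow_div_factorial_le_exp (γ * X) (by positivity) p
  rw [div_le_iff₀ (by positivity), mul_pow] at h
  rw [Real.exp_neg, ← div_eq_mul_inv, div_le_div_iff₀ (Real.exp_pos _) (by positivity)]
  linarith

/-- The error estimate once the small divisors up to frequency `X` are at least `C N⁻¹ X ^ 2`. -/
theorem HasAnalyticRadius.exists_birkhoffError_le_exp {f : UnitAddTorus (Fin d) → ℂ} {r C : ℝ}
    (hd : 1 ≤ d) (hr : 0 < r) (hf : HasAnalyticRadius f r) :
    ∃ K : ℝ, 0 ≤ K ∧ ∀ (ρ : UnitAddTorus (Fin d)) (N : ℕ) (X : ℝ), 2 ≤ N → 0 ≤ X →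
      (∀ k : Fin d → ℤ, k ≠ 0 → ∑ j, |(k j : ℝ)| ≤ X → C * X ^ 2 / N ≤ ‖∑ j, k j • ρ j‖) →
      ∀ θ, birkhoffError f ρ N θ ≤
        K * N * Real.exp (-(min (√C / 4) (Real.pi * r / (8 * d)) * X)) := by
  obtain ⟨K, hK0, hK⟩ := hf.exists_birkhoffError_le hd hr
  refine ⟨2 * K, by positivity, fun ρ N X hN hX hk θ => ?_⟩
  refine (hK ρ N X _ hN hk θ).trans ?_
  have hN0 : (N : ℝ) ≠ 0 := by positivity
  have hsqrt : √(N * (C * X ^ 2 / N)) = √C * X := by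
    rw [mul_div_cancel₀ _ hN0, Real.sqrt_mul' _ (sq_nonneg X), Real.sqrt_sq hX]
  rw [hsqrt]
  set β := min (√C / 4) (Real.pi * r / (8 * d)) with hβ
  have h1 : Real.exp (-(√C * X / 4)) ≤ Real.exp (-(β * X)) := by
    refine Real.exp_le_exp.2 (neg_le_neg ?_)
    rw [mul_div_right_comm]
    exact mul_le_mul_of_nonneg_right (min_le_left _ _) hX
  have h2 : Real.exp (-(Real.pi * r / (8 * d) * X)) ≤ Real.exp (-(β * X)) :=
    Real.exp_le_exp.2 (neg_le_neg (mul_le_mul_of_nonneg_right (min_le_right _ _) hX))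
  calc K * N * (Real.exp (-(√C * X / 4)) + Real.exp (-(Real.pi * r / (8 * d) * X)))
      ≤ K * N * (Real.exp (-(β * X)) + Real.exp (-(β * X))) := by gcongr
    _ = 2 * K * N * Real.exp (-(β * X)) := by ring

/-- Rotations satisfying a Diophantine condition with optimal exponent. -/
theorem errorIsBigO_of_isDiophantine {C r : ℝ} (hd : 1 ≤ d) (hC : 0 < C) (hr : 0 < r)
    {ρ : UnitAddTorus (Fin d)} (hρ : IsDiophantine ρ C) {f : UnitAddTorus (Fin d) → ℂ}
    (hf : HasAnalyticRadius f r) :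
    ErrorIsBigO f ρ fun N : ℕ => Real.exp (-(min (√C / 4) (Real.pi * r / (8 * d)) / 2 *
      (N : ℝ) ^ (1 / ((d : ℝ) + 2)))) := by
  obtain ⟨K, hK0, hK⟩ := hf.exists_birkhoffError_le_exp (C := C) hd hr
  set β := min (√C / 4) (Real.pi * r / (8 * d)) with hβ
  have hd' : (0 : ℝ) < d := by exact_mod_cast hd
  have hβ0 : 0 < β := by
    have := Real.pi_pos
    exact lt_min (by positivity) (by positivity)
  refine ⟨K * ((d + 2)! / (β / 2) ^ (d + 2)), eventually_atTop.2 ⟨2, fun N hN θ => ?_⟩⟩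
  have hN0 : (0 : ℝ) < N := by positivity
  -- Chosen so that `C X² / N = C / X^d`, the divisor bound at the cutoff.
  set X := (N : ℝ) ^ (1 / ((d : ℝ) + 2)) with hX
  have hX0 : 0 < X := Real.rpow_pos_of_pos hN0 _
  have hXN : X ^ (d + 2) = N := by
    rw [hX, one_div, show (d : ℝ) + 2 = ((d + 2 : ℕ) : ℝ) by push_cast; rfl]
    exact Real.rpow_inv_natCast_pow hN0.le (by omega)
  refine (hK ρ N X hN hX0.le (fun k hk hkX => ?_) θ).trans ?_
  · refine le_trans ?_ (hρ k hk).le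
    have hs := one_le_sum_abs hk
    rw [← hXN, pow_add, mul_div_mul_right _ _ (by positivity)]
    gcongr
  · have h := pow_mul_exp_neg_mul_le hX0.le (half_pos hβ0) (d + 2)
    rw [hXN] at h
    have e : Real.exp (-(β * X)) = Real.exp (-(β / 2 * X)) * Real.exp (-(β / 2 * X)) := by
      rw [← Real.exp_add]
      ring_nf
    calc K * N * Real.exp (-(β * X))
        = K * (N * Real.exp (-(β / 2 * X))) * Real.exp (-(β / 2 * X)) := by rw [e]; ring
      _ ≤ K * ((d + 2)! / (β / 2) ^ (d + 2)) * Real.exp (-(β / 2 * X)) := by gcongr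

/-- Comparison of the exponents with different powers of the logarithm. -/
theorem eventually_log_add_le {p a b β : ℝ} (hp : 0 < p) (hab : a < b) (hβ : 0 < β) :
    ∀ᶠ N : ℕ in atTop, Real.log N + (N : ℝ) ^ p * Real.log N ^ (-b) ≤
      β * ((N : ℝ) ^ p * Real.log N ^ (-a)) := by
  have hlog : Tendsto (fun N : ℕ => Real.log N) atTop atTop :=
    Real.tendsto_log_atTop.comp tendsto_natCast_atTop_atTop
  have h1 : ∀ᶠ N : ℕ in atTop, Real.log N ^ (1 + a) ≤ β / 2 * (N : ℝ) ^ p := by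
    have := ((isLittleO_log_rpow_rpow_atTop (1 + a) hp).comp_tendsto
      tendsto_natCast_atTop_atTop).def (half_pos hβ)
    filter_upwards [this] with N hN
    simp only [Function.comp_apply] at hN
    rw [Real.norm_of_nonneg (by positivity : (0 : ℝ) ≤ (N : ℝ) ^ p)] at hN
    exact (le_abs_self _).trans hN
  have h2 : ∀ᶠ N : ℕ in atTop, Real.log N ^ (-(b - a)) ≤ β / 2 :=
    ((tendsto_rpow_neg_atTop (sub_pos.2 hab)).comp hlog).eventually_le_const (half_pos hβ)
  filter_upwards [h1, h2, hlog.eventually_gt_atTop 0] with N h1 h2 hL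
  have hLa : 0 < Real.log N ^ (-a) := Real.rpow_pos_of_pos hL _
  have e1 : Real.log N = Real.log N ^ (1 + a) * Real.log N ^ (-a) := by
    rw [← Real.rpow_add hL]
    simp
  have e2 : Real.log N ^ (-b) = Real.log N ^ (-(b - a)) * Real.log N ^ (-a) := by
    rw [← Real.rpow_add hL]
    congr 1
    ring
  calc Real.log N + (N : ℝ) ^ p * Real.log N ^ (-b)
      = Real.log N ^ (1 + a) * Real.log N ^ (-a) +
          (N : ℝ) ^ p * (Real.log N ^ (-(b - a)) * Real.log N ^ (-a)) := by rw [← e1, ← e2]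
    _ ≤ β / 2 * (N : ℝ) ^ p * Real.log N ^ (-a) +
          (N : ℝ) ^ p * (β / 2 * Real.log N ^ (-a)) := by gcongr
    _ = β * ((N : ℝ) ^ p * Real.log N ^ (-a)) := by ring

/-- Rotations satisfying a Diophantine condition with logarithmic loss. -/
theorem errorIsBigO_of_logDiophantine {C ζ ζ' : ℝ} (hd : 1 ≤ d) (hC : 0 < C) (hζ' : 0 < ζ')
    (hζ : ζ' < ζ) {ρ : UnitAddTorus (Fin d)}
    (hρ : ∀ k : Fin d → ℤ, k ≠ 0 →
      C / ((∑ i, |(k i : ℝ)|) ^ d * (1 + Real.log (∑ i, |(k i : ℝ)|)) ^ ζ') ≤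
        ‖∑ i, k i • ρ i‖) {f : UnitAddTorus (Fin d) → ℂ} (hf : IsAnalytic f) :
    ErrorIsBigO f ρ fun N : ℕ => Real.exp (-(1 * (N : ℝ) ^ (1 / ((d : ℝ) + 2)) *
      (Real.log N) ^ (-(ζ / ((d : ℝ) + 2))))) := by
  obtain ⟨r, hr, hfr⟩ := (isAnalytic_iff f).1 hf
  obtain ⟨K, hK0, hK⟩ := hfr.exists_birkhoffError_le_exp (C := C) hd hr
  set β := min (√C / 4) (Real.pi * r / (8 * d)) with hβ
  have hd' : (0 : ℝ) < d := by exact_mod_cast hd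
  have hβ0 : 0 < β := by
    have := Real.pi_pos
    exact lt_min (by positivity) (by positivity)
  have hd2 : (0 : ℝ) < (d : ℝ) + 2 := by positivity
  have hlog : Tendsto (fun N : ℕ => Real.log N) atTop atTop :=
    Real.tendsto_log_atTop.comp tendsto_natCast_atTop_atTop
  refine ⟨K, ?_⟩
  filter_upwards [eventually_ge_atTop 2, hlog.eventually_ge_atTop 2,
    eventually_log_add_le (p := 1 / ((d : ℝ) + 2)) (a := ζ' / (d + 2)) (b := ζ / (d + 2))
      (by positivity) (by gcongr) hβ0] with N hN hL hcmp θ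
  have hN0 : (0 : ℝ) < N := by positivity
  have hL0 : 0 < Real.log N := by linarith
  -- Solves `X^(d+2) (log N)^ζ' = N`, so that `C X² / N` matches the divisor bound with `log N` in
  -- place of `1 + log s`.
  set X := (N : ℝ) ^ (1 / ((d : ℝ) + 2)) * Real.log N ^ (-(ζ' / ((d : ℝ) + 2))) with hX
  have hX0 : 0 < X := by positivity
  have hXpow : X ^ (d + 2) * Real.log N ^ ζ' = N := by
    have hc : ((d + 2 : ℕ) : ℝ) = (d : ℝ) + 2 := by push_cast; rfl
    rw [hX, mul_pow, ← Real.rpow_natCast, ← Real.rpow_natCast, ← Real.rpow_mul hN0.le,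
      ← Real.rpow_mul hL0.le, hc, neg_mul, div_mul_cancel₀ _ hd2.ne', div_mul_cancel₀ _ hd2.ne',
      Real.rpow_one, mul_assoc, ← Real.rpow_add hL0, neg_add_cancel, Real.rpow_zero, mul_one]
  have hXle : X ≤ (N : ℝ) ^ (1 / ((d : ℝ) + 2)) :=
    mul_le_of_le_one_right (by positivity)
      (Real.rpow_le_one_of_one_le_of_nonpos (by linarith) (neg_nonpos.2 (by positivity)))
  refine (hK ρ N X hN hX0.le (fun k hk hkX => ?_) θ).trans ?_
  · refine le_trans ?_ (hρ k hk)
    have hs := one_le_sum_abs hk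
    set s := ∑ i, |(k i : ℝ)| with hsdef
    have hlogs : 0 ≤ Real.log s := Real.log_nonneg hs
    -- Since `s ≤ N^{1/(d+2)}`, `log s ≤ (log N)/2`; the remaining half covers the `1` once `log N ≥
    -- 2`.
    have hlog1 : 1 + Real.log s ≤ Real.log N := by
      have h := Real.log_le_log (by linarith) (hkX.trans hXle)
      rw [Real.log_rpow hN0] at h
      have : 1 / ((d : ℝ) + 2) ≤ 1 / 2 := by
        gcongr
        linarith
      nlinarith
    have hrhs : C * X ^ 2 / N = C / (X ^ d * Real.log N ^ ζ') := by
      rw [div_eq_div_iff hN0.ne' (by positivity)]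
      linear_combination C * hXpow
    rw [hrhs]
    have : 0 < 1 + Real.log s := by linarith
    gcongr
  · rw [mul_assoc]
    refine mul_le_mul_of_nonneg_left ?_ hK0
    calc (N : ℝ) * Real.exp (-(β * X)) = Real.exp (Real.log N + -(β * X)) := by
          rw [Real.exp_add, Real.exp_log hN0]
      _ ≤ _ := by
          refine Real.exp_le_exp.2 ?_
          rw [one_mul]
          linarith

theorem errorIsBigO_trigPoly {S : Finset (Fin d → ℤ)} {ρ : UnitAddTorus (Fin d)} {D : ℝ}
    (hD0 : 0 < D) (hD : ∀ k ∈ S, k ≠ 0 → D ≤ ‖∑ j, k j • ρ j‖) (a : (Fin d → ℤ) → ℂ) :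
    ErrorIsBigO (trigPoly S a) ρ fun N : ℕ => Real.exp (-(√D / 8 * √(N : ℝ))) := by
  have hγ : 0 < √D / 8 := by positivity
  refine ⟨(∑ k ∈ S, ‖a k‖) * (6 * Real.exp 6 * (2 ! / (√D / 8) ^ 2)),
    eventually_atTop.2 ⟨2, fun N hN θ => ?_⟩⟩
  refine (birkhoffError_trigPoly_le S a hD hN θ).trans ?_
  have h := pow_mul_exp_neg_mul_le (Real.sqrt_nonneg N) hγ 2
  rw [Real.sq_sqrt (Nat.cast_nonneg N)] at h
  have e : Real.exp (-(√(N * D) / 4)) =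
      Real.exp (-(√D / 8 * √N)) * Real.exp (-(√D / 8 * √N)) := by
    rw [← Real.exp_add, Real.sqrt_mul (Nat.cast_nonneg N)]
    ring_nf
  rw [mul_assoc (∑ k ∈ S, ‖a k‖)]
  refine mul_le_mul_of_nonneg_left ?_ (Finset.sum_nonneg fun k _ => norm_nonneg (a k))
  calc 6 * Real.exp 6 * N * Real.exp (-(√(N * D) / 4))
      = 6 * Real.exp 6 * (N * Real.exp (-(√D / 8 * √N))) * Real.exp (-(√D / 8 * √N)) := by
        rw [e]
        ring
    _ ≤ 6 * Real.exp 6 * (2 ! / (√D / 8) ^ 2) * Real.exp (-(√D / 8 * √N)) := by gcongr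

end WeightedBirkhoff

end

theorem theorem6p1 :
    -- (I) analytic observables, almost every rotation
    (∃ cI : ℝ, 0 < cI ∧ ∀ d : ℕ, 1 ≤ d →
      ∀ᵐ ρ : UnitAddTorus (Fin d), ∀ f : UnitAddTorus (Fin d) → ℂ,
        WeightedBirkhoff.IsAnalytic f → ∀ ζ : ℝ, 1 < ζ →
          WeightedBirkhoff.ErrorIsBigO f ρ (fun N : ℕ =>
            Real.exp (-(cI * (N : ℝ) ^ (1 / ((d : ℝ) + 2)) *
              (Real.log N) ^ (-(ζ / ((d : ℝ) + 2))))))) ∧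
    -- (II) analytic observables, Diophantine rotations
    (∀ d : ℕ, 1 ≤ d → ∀ C : ℝ, 0 < C → ∀ r : ℝ, 0 < r →
      ∃ cII : ℝ, 0 < cII ∧ ∀ ρ : UnitAddTorus (Fin d), WeightedBirkhoff.IsDiophantine ρ C →
        ∀ f : UnitAddTorus (Fin d) → ℂ, WeightedBirkhoff.HasAnalyticRadius f r →
          WeightedBirkhoff.ErrorIsBigO f ρ (fun N : ℕ =>
            Real.exp (-(cII * (N : ℝ) ^ (1 / ((d : ℝ) + 2)))))) ∧
    -- (III) trigonometric polynomials, almost every rotation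
    (∀ d : ℕ, 1 ≤ d → ∀ᵐ ρ : UnitAddTorus (Fin d), ∀ S : Finset (Fin d → ℤ),
      ∃ cIII : ℝ, 0 < cIII ∧ ∀ a : (Fin d → ℤ) → ℂ,
        WeightedBirkhoff.ErrorIsBigO (WeightedBirkhoff.trigPoly S a) ρ (fun N : ℕ =>
          Real.exp (-(cIII * √(N : ℝ))))) := by
  -- In (I) any positive constant would do: using an exponent strictly between `1` and `ζ` gains a
  -- power of `ln N`, which beats every constant depending on `ρ` and `f`.
  refine ⟨⟨1, one_pos, fun d hd => ?_⟩, fun d hd C hC r hr => ?_, fun d _ => ?_⟩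
  · have hae : ∀ᵐ ρ : UnitAddTorus (Fin d), ∀ n : ℕ, ∃ C : ℝ, 0 < C ∧ ∀ k : Fin d → ℤ, k ≠ 0 →
        C / ((∑ i, |(k i : ℝ)|) ^ d *
          (1 + Real.log (∑ i, |(k i : ℝ)|)) ^ (1 + 1 / ((n : ℝ) + 1))) ≤ ‖∑ i, k i • ρ i‖ :=
      ae_all_iff.2 fun n => WeightedBirkhoff.ae_exists_logDiophantine d
        (lt_add_of_pos_right 1 Nat.one_div_pos_of_nat)
    filter_upwards [hae] with ρ hρ f hf ζ hζ
    obtain ⟨n, hn⟩ := exists_nat_one_div_lt (sub_pos.2 hζ)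
    obtain ⟨C, hC, hk⟩ := hρ n
    exact WeightedBirkhoff.errorIsBigO_of_logDiophantine hd hC (by positivity) (by linarith) hk hf
  · have hd' : (0 : ℝ) < d := by exact_mod_cast hd
    have := Real.pi_pos
    exact ⟨_, half_pos (lt_min (by positivity) (by positivity)), fun ρ hρ f hf =>
      WeightedBirkhoff.errorIsBigO_of_isDiophantine hd hC hr hρ hf⟩
  · filter_upwards [WeightedBirkhoff.ae_sum_zsmul_ne_zero d] with ρ hρ S
    obtain ⟨D, hD0, hD⟩ := WeightedBirkhoff.exists_pos_forall_le (S.erase 0)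
      (fun k => ‖∑ j, k j • ρ j‖) fun k hk => hρ k (Finset.ne_of_mem_erase hk)
    exact ⟨√D / 8, by positivity, fun a => WeightedBirkhoff.errorIsBigO_trigPoly hD0
      (fun k hk hk0 => hD k (Finset.mem_erase.2 ⟨hk0, hk⟩)) a⟩
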